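/- Let $k$ be an algebraically closed field of characteristic $0$, let $g,n$ be integers with $n\ge 0$ and $2n\le g-1$, and let $F=\sum_{i=1}^{g-2}F_it^{-i}$ with $F_i\in k$. Let $C$ be the ribbon of genus $g$ over $k$ with gluing data $F$: it is covered by the affine open subschemes $U_1\cong\operatorname{Spec}k[s,\epsilon]/\epsilon^2$ and $U_2\cong\operatorname{Spec}k[t,\eta]/\eta^2$, with $U_1\cap U_2\cong\operatorname{Spec}k[t,t^{-1},\eta]/\eta^2$, where $$\epsilon=t^{-g-1}\eta,\qquad s^{-1}=t+F(t)\eta\qquad\text{on }U_1\cap U_2 .$$ The degree of a line bundle $L$ on $C$ is $\deg L=\chi(L)-\chi(\mathcal O_C)$; $\operatorname{Pic}^{d}(C)$ is the set of isomorphism classes of line bundles of degree $d$, and $W^r_{d}(C)=\{L\in\operatorname{Pic}^{d}(C)\mid h^0(C,L)\ge r+1\}$ for an integer $r\ge 0$. For $(G_1,\dots,G_g)\in\mathbb A^g=k^g$ put $G=\sum_{j=1}^gG_jt^{-j}$; the line bundle with coordinates $(G_1,\dots,G_g)$ is the one that is free on $U_1$ and on $U_2$ with generators $e_1$, $e_2$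 satisfying $$e_1=(t+F\eta)^n(1+G\eta)\,e_2\qquad\text{on }U_1\cap U_2 .$$ Let $\mathcal A_F(G)$ be the $(g-n)\times(n+1)$ matrix with entries $s_{ij}=G_{i+j-1}+(j-1)F_{i+j-2}$ for $1\le i\le g-n$, $1\le j\le n+1$, where $F_m=0$ for $m\notin\{1,\dots,g-2\}$. Then sending $(G_1,\dots,G_g)$ to the class of the line bundle with these coordinates is a well-defined bijection $\mathbb A^g\to\operatorname{Pic}^{2n}(C)$, and for every $r\ge 0$ it restricts to a bijection from the affine algebraic set $$\{(G_1,\dots,G_g)\in\mathbb A^g\mid\operatorname{rank}\mathcal A_F(G)\le n-r\}$$ onto $W^r_{2n}(C)$. -/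

import Mathlib

open AlgebraicGeometry CategoryTheory TopologicalSpace
open scoped Polynomial LaurentPolynomial DualNumber

universe u

noncomputable section

namespace Ribbon

/-! ## The gluing maps -/

/-- The `m`-th entry `a_m` of a finite list `(a_1, …, a_N)`, with `a_m = 0` for `m = 0`
and for `m > N`. -/
def entry {k : Type u} [Zero k] {N : ℕ} (a : Fin N → k) (m : ℕ) : k :=
  if h : 1 ≤ m ∧ m ≤ N then a ⟨m - 1, by omega⟩ else 0

/-- The Laurent polynomial `∑_{i=1}^N a_i t^{-i}` attached to `(a_1, …, a_N)`. -/
def tail {k : Type u} [Field k] {N : ℕ} (a : Fin N → k) : k[T;T⁻¹] :=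
  ∑ i : Fin N, LaurentPolynomial.C (a i) * LaurentPolynomial.T (-((i : ℤ) + 1))

/-- The unit `t + F(t) η` of `k[t, t⁻¹, η]/η²`, with inverse `t⁻¹ - t⁻² F(t) η`. -/
def tUnit {k : Type u} [Field k] (F : k[T;T⁻¹]) : (DualNumber k[T;T⁻¹])ˣ where
  val := TrivSqZeroExt.inl (LaurentPolynomial.T 1) + TrivSqZeroExt.inr F
  inv := TrivSqZeroExt.inl (LaurentPolynomial.T (-1)) -
    TrivSqZeroExt.inr (LaurentPolynomial.T (-2) * F)
  val_inv := by
    have h1 : (LaurentPolynomial.T 1 * LaurentPolynomial.T (-1) : k[T;T⁻¹]) = 1 := by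
      rw [← LaurentPolynomial.T_add]; exact LaurentPolynomial.T_zero
    have h2 : (LaurentPolynomial.T 1 * LaurentPolynomial.T (-2) : k[T;T⁻¹]) =
        LaurentPolynomial.T (-1) := (LaurentPolynomial.T_add 1 (-2)).symm
    refine TrivSqZeroExt.ext ?_ ?_
    · simp only [TrivSqZeroExt.fst_mul, TrivSqZeroExt.fst_add, TrivSqZeroExt.fst_sub,
        TrivSqZeroExt.fst_inl, TrivSqZeroExt.fst_inr, TrivSqZeroExt.fst_one, add_zero, sub_zero]
      exact h1
    · simp only [TrivSqZeroExt.snd_mul, TrivSqZeroExt.fst_add, TrivSqZeroExt.fst_sub,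
        TrivSqZeroExt.snd_add, TrivSqZeroExt.snd_sub, TrivSqZeroExt.fst_inl,
        TrivSqZeroExt.fst_inr, TrivSqZeroExt.snd_inl, TrivSqZeroExt.snd_inr,
        TrivSqZeroExt.snd_one, smul_eq_mul, op_smul_eq_mul]
      linear_combination (-F) * h2
  inv_val := by
    have h1 : (LaurentPolynomial.T 1 * LaurentPolynomial.T (-1) : k[T;T⁻¹]) = 1 := by
      rw [← LaurentPolynomial.T_add]; exact LaurentPolynomial.T_zero
    have h2 : (LaurentPolynomial.T 1 * LaurentPolynomial.T (-2) : k[T;T⁻¹]) =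
        LaurentPolynomial.T (-1) := (LaurentPolynomial.T_add 1 (-2)).symm
    refine TrivSqZeroExt.ext ?_ ?_
    · simp only [TrivSqZeroExt.fst_mul, TrivSqZeroExt.fst_add, TrivSqZeroExt.fst_sub,
        TrivSqZeroExt.fst_inl, TrivSqZeroExt.fst_inr, TrivSqZeroExt.fst_one, add_zero, sub_zero]
      rw [mul_comm]; exact h1
    · simp only [TrivSqZeroExt.snd_mul, TrivSqZeroExt.fst_add, TrivSqZeroExt.fst_sub,
        TrivSqZeroExt.snd_add, TrivSqZeroExt.snd_sub, TrivSqZeroExt.fst_inl,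
        TrivSqZeroExt.fst_inr, TrivSqZeroExt.snd_inl, TrivSqZeroExt.snd_inr,
        TrivSqZeroExt.snd_one, smul_eq_mul, op_smul_eq_mul]
      linear_combination (-F) * h2

/-- For elements `x`, `e` of a commutative `k`-algebra with `e² = 0`, the `k`-algebra map out of
`k[x, ε]/ε²` which sends the variable to `x` and `ε` to `e`. -/
def dualEval {k B : Type u} [Field k] [CommRing B] [Algebra k B] (x e : B) (he : e * e = 0) :
    DualNumber k[X] →ₐ[k] B :=
  DualNumber.lift ⟨(Polynomial.aeval x, e), he, fun _ => Commute.all _ _⟩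

/-- Restriction from `U₁ = Spec k[s, ε]/ε²` to the overlap: `s⁻¹ = t + F(t) η` and
`ε = t^{-g-1} η`. -/
def rho₁ {k : Type u} [Field k] (g : ℕ) (F : k[T;T⁻¹]) :
    DualNumber k[X] →ₐ[k] DualNumber k[T;T⁻¹] :=
  dualEval (((tUnit F)⁻¹ : (DualNumber k[T;T⁻¹])ˣ) : DualNumber k[T;T⁻¹])
    (TrivSqZeroExt.inr (LaurentPolynomial.T (-(g : ℤ) - 1)))
    (TrivSqZeroExt.inr_mul_inr _ _ _)

/-- Restriction from `U₂ = Spec k[t, η]/η²` to the overlap: the inclusion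
`k[t, η]/η² ⊆ k[t, t⁻¹, η]/η²`. -/
def rho₂ {k : Type u} [Field k] : DualNumber k[X] →ₐ[k] DualNumber k[T;T⁻¹] :=
  dualEval (TrivSqZeroExt.inl (LaurentPolynomial.T 1)) DualNumber.eps
    DualNumber.eps_mul_eps

/-! ## Schemes over a field -/

/-- The scalars `k → Γ(C, U)` of a `k`-scheme `π : C ⟶ Spec k`. -/
def scalar {k : Type u} [Field k] {C : Scheme.{u}} (π : C ⟶ Spec (CommRingCat.of k))
    (U : C.Opens) : k →+* Γ(C, U) :=
  ((Scheme.ΓSpecIso (CommRingCat.of k)).inv ≫ π.appTop ≫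
    C.presheaf.map (homOfLE le_top).op).hom

/-- The `k`-vector space structure on the sections over `U` of an `𝒪_C`-module. -/
abbrev sectionsModule {k : Type u} [Field k] {C : Scheme.{u}} (π : C ⟶ Spec (CommRingCat.of k))
    (L : C.Modules) (U : C.Opens) : Module k Γ(L, U) :=
  Module.compHom Γ(L, U) (scalar π U)

/-- `h⁰(C, L) = dim_k Γ(C, L)`. -/
def h0 {k : Type u} [Field k] {C : Scheme.{u}} (π : C ⟶ Spec (CommRingCat.of k))
    (L : C.Modules) : ℕ :=
  letI := sectionsModule π L ⊤
  Module.finrank k Γ(L, ⊤)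

/-- Restriction of sections of an `𝒪_C`-module. -/
def res {C : Scheme.{u}} (L : C.Modules) {U V : C.Opens} (h : V ≤ U) (x : Γ(L, U)) : Γ(L, V) :=
  L.presheaf.map (homOfLE h).op x

/-- `e ∈ Γ(U, L)` generates `L` freely over `U`, that is `L|_U = 𝒪_U e`: on every open `V ⊆ U`,
each section of `L` is `f • e|_V` for exactly one function `f`. -/
def IsFrame {C : Scheme.{u}} (L : C.Modules) (U : C.Opens) (e : Γ(L, U)) : Prop :=
  ∀ (V : C.Opens) (h : V ≤ U), Function.Bijective fun f : Γ(C, V) => f • res L h e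

/-- A line bundle: an `𝒪_C`-module which is locally free of rank one. -/
def IsLineBundle {C : Scheme.{u}} (L : C.Modules) : Prop :=
  ∀ x : C, ∃ U : C.Opens, x ∈ U ∧ ∃ e : Γ(L, U), IsFrame L U e

/-- Isomorphism classes of `𝒪_C`-modules. -/
abbrev IsoClass (C : Scheme.{u}) : Type (u + 1) :=
  Quotient (isIsomorphicSetoid C.Modules)

/-- The isomorphism class of an `𝒪_C`-module. -/
def isoClass {C : Scheme.{u}} (L : C.Modules) : IsoClass C :=
  Quotient.mk (isIsomorphicSetoid C.Modules) L

/-! ## Ribbons and their line bundles -/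

/-- A presentation of the `k`-scheme `C` as the ribbon of genus `g` with gluing data
`F = ∑_{i=1}^{g-2} F_i t^{-i}`: an affine open cover `C = U₁ ∪ U₂` with
`U₁ ≅ Spec k[s, ε]/ε²`, `U₂ ≅ Spec k[t, η]/η²` and `U₁ ∩ U₂ ≅ Spec k[t, t⁻¹, η]/η²` over `k`, where
`ε = t^{-g-1} η` and `s⁻¹ = t + F(t) η` on `U₁ ∩ U₂`. -/
structure Gluing {k : Type u} [Field k] {C : Scheme.{u}} (π : C ⟶ Spec (CommRingCat.of k))
    (g : ℕ) (F : Fin (g - 2) → k) where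
  U₁ : C.Opens
  U₂ : C.Opens
  cover : U₁ ⊔ U₂ = ⊤
  affine₁ : IsAffineOpen U₁
  affine₂ : IsAffineOpen U₂
  affine₁₂ : IsAffineOpen (U₁ ⊓ U₂)
  φ₁ : Γ(C, U₁) ≃+* DualNumber k[X]
  φ₂ : Γ(C, U₂) ≃+* DualNumber k[X]
  φ₁₂ : Γ(C, U₁ ⊓ U₂) ≃+* DualNumber k[T;T⁻¹]
  scalar₁ : ∀ a : k, φ₁ (scalar π U₁ a) = algebraMap k (DualNumber k[X]) a
  scalar₂ : ∀ a : k, φ₂ (scalar π U₂ a) = algebraMap k (DualNumber k[X]) a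
  res₁ : ∀ f : Γ(C, U₁),
    φ₁₂ (C.presheaf.map (homOfLE inf_le_left).op f) = rho₁ g (tail F) (φ₁ f)
  res₂ : ∀ f : Γ(C, U₂),
    φ₁₂ (C.presheaf.map (homOfLE inf_le_right).op f) = rho₂ (φ₂ f)

namespace Gluing

variable {k : Type u} [Field k] {C : Scheme.{u}} {π : C ⟶ Spec (CommRingCat.of k)}
  {g : ℕ} {F : Fin (g - 2) → k}

/-- `h¹(C, L)`: the dimension of the Čech cohomology
`H¹ = Γ(U₁ ∩ U₂, L) / (Γ(U₁, L)|_{U₁ ∩ U₂} + Γ(U₂, L)|_{U₁ ∩ U₂})` for the affine cover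
`C = U₁ ∪ U₂`. -/
def h1 (D : Gluing π g F) (L : C.Modules) : ℕ :=
  letI := sectionsModule π L (D.U₁ ⊓ D.U₂)
  Module.finrank k (Γ(L, D.U₁ ⊓ D.U₂) ⧸
    Submodule.span k
      (Set.range (res L (inf_le_left : D.U₁ ⊓ D.U₂ ≤ D.U₁)) ∪
        Set.range (res L (inf_le_right : D.U₁ ⊓ D.U₂ ≤ D.U₂))))

/-- The Euler characteristic `χ(L) = h⁰(L) - h¹(L)` (the cover has two members, so there is no
higher cohomology). -/
def chi (D : Gluing π g F) (L : C.Modules) : ℤ :=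
  (h0 π L : ℤ) - (D.h1 L : ℤ)

/-- `deg L = χ(L) - χ(𝒪_C)`. -/
def degree (D : Gluing π g F) (L : C.Modules) : ℤ :=
  D.chi L - D.chi (SheafOfModules.unit C.ringCatSheaf)

/-- `Pic^d(C)`: the isomorphism classes of line bundles of degree `d`. -/
def Pic (D : Gluing π g F) (d : ℤ) : Set (IsoClass C) :=
  {c | ∃ L : C.Modules, IsLineBundle L ∧ D.degree L = d ∧ isoClass L = c}

/-- `W^r_d(C)`: the isomorphism classes of line bundles `L` of degree `d` with
`h⁰(C, L) ≥ r + 1`. -/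
def W (D : Gluing π g F) (r : ℕ) (d : ℤ) : Set (IsoClass C) :=
  {c | ∃ L : C.Modules, IsLineBundle L ∧ D.degree L = d ∧ r + 1 ≤ h0 π L ∧ isoClass L = c}

/-- `L` is given by the coordinates `(G_1, …, G_g)`: `L|_{U₁} = 𝒪 e₁`, `L|_{U₂} = 𝒪 e₂` and
`e₁ = (t + F η)^n (1 + G η) e₂` on `U₁ ∩ U₂`, where `G = ∑_{j=1}^g G_j t^{-j}`. -/
def HasCoordinates (D : Gluing π g F) (n : ℕ) (G : Fin g → k) (L : C.Modules) : Prop :=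
  ∃ (e₁ : Γ(L, D.U₁)) (e₂ : Γ(L, D.U₂)), IsFrame L D.U₁ e₁ ∧ IsFrame L D.U₂ e₂ ∧
    res L (inf_le_left : D.U₁ ⊓ D.U₂ ≤ D.U₁) e₁ =
      D.φ₁₂.symm ((tUnit (tail F) : DualNumber k[T;T⁻¹]) ^ n * (1 + TrivSqZeroExt.inr (tail G))) •
        res L (inf_le_right : D.U₁ ⊓ D.U₂ ≤ D.U₂) e₂

end Gluing

/-- The `(g-n) × (n+1)` matrix `A_F(G)`, whose `(i, j)` entry for `1 ≤ i ≤ g - n`,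
`1 ≤ j ≤ n + 1` is `G_{i+j-1} + (j-1) F_{i+j-2}`, where `F_m = 0` for `m ∉ {1, …, g-2}`.
(The indices of `Fin` start at `0`.) -/
def matrixA {k : Type u} [Field k] {g : ℕ} (n : ℕ) (F : Fin (g - 2) → k) (G : Fin g → k) :
    Matrix (Fin (g - n)) (Fin (n + 1)) k :=
  Matrix.of fun i j =>
    entry G ((i : ℕ) + j + 1) + ((j : ℕ) : k) * entry F ((i : ℕ) + j)

/-- The determinantal locus `{G ∈ 𝔸^g : rank A_F(G) ≤ n - r}`. -/
def locus {k : Type u} [Field k] {g : ℕ} (n r : ℕ) (F : Fin (g - 2) → k) : Set (Fin g → k) :=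
  {G | ((matrixA n F G).rank : ℤ) ≤ (n : ℤ) - r}

/-! ## Ribbons with given gluing data exist -/

section Existence

open Limits

variable {k : Type u} [Field k]

lemma dualEval_apply (x e : DualNumber k[T;T⁻¹]) (he) (y : DualNumber k[X]) :
    dualEval x e he y = Polynomial.aeval x y.fst + Polynomial.aeval x y.snd * e := rfl

lemma isLocalization_dualEval (σ : k[X] →ₐ[k] k[T;T⁻¹]) (x : (DualNumber k[T;T⁻¹])ˣ) (b : ℤ)
    (hx : (x : DualNumber k[T;T⁻¹]).fst = σ Polynomial.X) (hσ : Function.Injective σ)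
    (hs : ∀ f, ∃ (m : ℕ) (p : k[X]), σ p = f * σ Polynomial.X ^ m) (he) :
    letI : Algebra (DualNumber k[X]) (DualNumber k[T;T⁻¹]) := (dualEval (k := k) (x : DualNumber k[T;T⁻¹]) (TrivSqZeroExt.inr (LaurentPolynomial.T b)) he).toRingHom.toAlgebra
    IsLocalization.Away (TrivSqZeroExt.inl Polynomial.X : DualNumber k[X]) (DualNumber k[T;T⁻¹]) := by
  let inst : Algebra (DualNumber k[X]) (DualNumber k[T;T⁻¹]) := (dualEval (k := k) (x : DualNumber k[T;T⁻¹]) (TrivSqZeroExt.inr (LaurentPolynomial.T b)) he).toRingHom.toAlgebra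
  set ρ := dualEval (k := k) (x : DualNumber k[T;T⁻¹]) (TrivSqZeroExt.inr (LaurentPolynomial.T b)) he with hρ
  have hX : ρ (TrivSqZeroExt.inl Polynomial.X) = x := by
    simp [hρ, dualEval_apply]
  have hev : ∀ p : k[X], (Polynomial.aeval (x : DualNumber k[T;T⁻¹]) p).fst = σ p := by
    intro p
    have : (TrivSqZeroExt.fstHom k k[T;T⁻¹] k[T;T⁻¹]).comp
        (Polynomial.aeval (x : DualNumber k[T;T⁻¹])) = σ := by
      ext; simp [hx]
    exact DFunLike.congr_fun this p
  have hfst : ∀ y, (ρ y).fst = σ y.fst := by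
    intro y; simp [hρ, dualEval_apply, hev]
  have hsnd : ∀ y, (ρ y).snd = (Polynomial.aeval (x : DualNumber k[T;T⁻¹]) y.fst).snd +
      σ y.snd * LaurentPolynomial.T b := by
    intro y; simp [hρ, dualEval_apply, hev]
  have hinr : ∀ d : k[T;T⁻¹], ∃ (m : ℕ) (y : DualNumber k[X]),
      ρ y = TrivSqZeroExt.inr d * (x : DualNumber k[T;T⁻¹]) ^ m := by
    intro d
    obtain ⟨m, p, hp⟩ := hs (d * LaurentPolynomial.T (-b))
    refine ⟨m, TrivSqZeroExt.inr p, TrivSqZeroExt.ext ?_ ?_⟩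
    · rw [hfst]; simp
    · rw [hsnd]
      simp [hp, hx, TrivSqZeroExt.fst_pow]
      have : (LaurentPolynomial.T (-b) * LaurentPolynomial.T b : k[T;T⁻¹]) = 1 := by
        rw [← LaurentPolynomial.T_add]; simp
      linear_combination (d * σ Polynomial.X ^ m) * this
  refine (isLocalization_iff _ _).mpr ⟨?_, ?_, ?_⟩
  · rintro ⟨_, m, rfl⟩
    change IsUnit (ρ _)
    simp only [map_pow]; rw [hX]; exact x.isUnit.pow m
  · intro z
    obtain ⟨m, p, hp⟩ := hs z.fst
    obtain ⟨l, y, hy⟩ := hinr ((z * (x : DualNumber k[T;T⁻¹]) ^ m).snd -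
      (ρ (TrivSqZeroExt.inl p)).snd)
    refine ⟨(TrivSqZeroExt.inl p * TrivSqZeroExt.inl Polynomial.X ^ l + y,
      ⟨TrivSqZeroExt.inl Polynomial.X ^ (m + l), m + l, rfl⟩), ?_⟩
    change z * ρ _ = ρ _
    simp only [map_pow, map_add, map_mul]
    rw [hX, hy, pow_add, ← mul_assoc, ← add_mul]
    congr 1
    refine TrivSqZeroExt.ext ?_ ?_
    · rw [TrivSqZeroExt.fst_add, hfst]
      simp [hp, hx, TrivSqZeroExt.fst_pow]
    · simp
  · intro y z h
    refine ⟨1, ?_⟩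
    have h : ρ y = ρ z := h
    have h1 : y.fst = z.fst := hσ (by rw [← hfst, ← hfst, h])
    have h2 := congrArg TrivSqZeroExt.snd h
    rw [hsnd, hsnd, h1] at h2
    have h3 : y.snd = z.snd := hσ ((LaurentPolynomial.isUnit_T b).mul_right_cancel (add_left_cancel h2))
    rw [TrivSqZeroExt.ext h1 h3]

lemma isOpenImmersion_rho₁ (g : ℕ) (F : k[T;T⁻¹]) :
    IsOpenImmersion (Spec.map (CommRingCat.ofHom (rho₁ g F).toRingHom)) := by
  let : Algebra (DualNumber k[X]) (DualNumber k[T;T⁻¹]) := (rho₁ g F).toRingHom.toAlgebra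
  have : IsLocalization.Away (TrivSqZeroExt.inl Polynomial.X : DualNumber k[X]) (DualNumber k[T;T⁻¹]) := isLocalization_dualEval ((LaurentPolynomial.invert (R := k)).toAlgHom.comp Polynomial.toLaurentAlg) (tUnit F)⁻¹ (-(g:ℤ) - 1)
    (by simp [tUnit]) (LaurentPolynomial.invert.injective.comp Polynomial.toLaurent_injective)
    (by
      intro f
      obtain ⟨n, p, hp⟩ := LaurentPolynomial.exists_T_pow (LaurentPolynomial.invert f)
      refine ⟨n, p, ?_⟩
      simp [hp]
      left
      exact (LaurentPolynomial.involutive_invert f)) (TrivSqZeroExt.inr_mul_inr _ _ _)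
  exact IsOpenImmersion.of_isLocalization (S := DualNumber k[T;T⁻¹]) (TrivSqZeroExt.inl Polynomial.X : DualNumber k[X])

lemma isOpenImmersion_rho₂ :
    IsOpenImmersion (Spec.map (CommRingCat.ofHom (rho₂ (k := k)).toRingHom)) := by
  let : Algebra (DualNumber k[X]) (DualNumber k[T;T⁻¹]) := (rho₂ (k := k)).toRingHom.toAlgebra
  have : IsLocalization.Away (TrivSqZeroExt.inl Polynomial.X : DualNumber k[X]) (DualNumber k[T;T⁻¹]) := isLocalization_dualEval (Polynomial.toLaurentAlg (R := k))
    ⟨TrivSqZeroExt.inl (LaurentPolynomial.T 1), TrivSqZeroExt.inl (LaurentPolynomial.T (-1)), by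
      rw [TrivSqZeroExt.inl_mul_inl, ← LaurentPolynomial.T_add]; simp, by
      rw [TrivSqZeroExt.inl_mul_inl, ← LaurentPolynomial.T_add]; simp⟩ 0
    (by simp) (Polynomial.toLaurent_injective)
    (by
      intro f
      obtain ⟨n, p, hp⟩ := LaurentPolynomial.exists_T_pow f
      refine ⟨n, p, ?_⟩
      simp [hp]) (TrivSqZeroExt.inr_mul_inr _ _ _)
  exact IsOpenImmersion.of_isLocalization (S := DualNumber k[T;T⁻¹]) (TrivSqZeroExt.inl Polynomial.X : DualNumber k[X])

/-- Two schemes can be glued along a common open subscheme. -/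
lemma exists_pushout {W X Y : Scheme.{u}} (f : W ⟶ X) (g : W ⟶ Y) [IsOpenImmersion f] [IsOpenImmersion g] :
    ∃ (P : Scheme.{u}) (i : X ⟶ P) (j : Y ⟶ P) (_ : IsOpenImmersion i) (_ : IsOpenImmersion j),
      IsPushout f g i j ∧ i.opensRange ⊔ j.opensRange = ⊤ ∧
      i.opensRange ⊓ j.opensRange = (f ≫ i).opensRange := by
  have h1 : ∀ {a b : WalkingSpan} (t : a ⟶ b), IsOpenImmersion ((span f g).map t) := by
    rintro a b (a | (a | a))
    · simp only [WidePushoutShape.hom_id, CategoryTheory.Functor.map_id]; infer_instance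
    · simpa
    · simpa
  have h2 : (span f g ⋙ Scheme.forget).IsLocallyDirected := by
    have (i : _) : Mono ((span f g ⋙ Scheme.forget).map (WidePushoutShape.Hom.init i)) := 
      (mono_iff_injective _).mpr ((span f g).map _).isOpenEmbedding.injective
    infer_instance
  have : HasPushout f g := inferInstanceAs (HasColimit (span f g))
  have i1 : IsOpenImmersion (pushout.inl f g) :=
    inferInstanceAs (IsOpenImmersion (colimit.ι (span f g) WalkingSpan.left))
  have i2 : IsOpenImmersion (pushout.inr f g) :=
    inferInstanceAs (IsOpenImmersion (colimit.ι (span f g) WalkingSpan.right))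
  refine ⟨pushout f g, pushout.inl f g, pushout.inr f g, i1, i2, IsPushout.of_hasPushout f g, ?_, ?_⟩
  · rw [eq_top_iff]
    rintro x -
    obtain ⟨a, y, rfl⟩ := Scheme.IsLocallyDirected.ι_jointly_surjective (span f g) x
    rcases a with _ | _ | _
    · left
      refine ⟨f y, ?_⟩
      have := colimit.w (span f g) WalkingSpan.Hom.fst
      rw [← this]; rfl
    · left; exact ⟨y, rfl⟩
    · right; exact ⟨y, rfl⟩
  · ext x
    constructor
    · rintro ⟨⟨a, ha⟩, ⟨b, hb⟩⟩
      obtain ⟨c, fi, fj, z, h1, h2⟩ := (Scheme.IsLocallyDirected.ι_eq_ι_iff (span f g) (i := WalkingSpan.left) (j := WalkingSpan.right) (xi := a) (xj := b)).mp (ha.trans hb.symm)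
      rcases c with _ | _ | _
      · refine ⟨z, ?_⟩
        rw [← ha, ← h1]
        have : fi = WalkingSpan.Hom.fst := Subsingleton.elim _ _
        subst this; rfl
      · rcases fj
      · rcases fi
    · rintro ⟨z, rfl⟩
      refine ⟨⟨f z, rfl⟩, ⟨g z, ?_⟩⟩
      change (g ≫ pushout.inr f g) z = _
      rw [← pushout.condition]

lemma chart {C : Scheme.{u}} {R : Type u} [CommRing R] (h : Spec (CommRingCat.of R) ⟶ C)
    [IsOpenImmersion h] (U : C.Opens) (hU : U = h.opensRange) :
    ∃ φ : Γ(C, U) ≃+* R, ∀ x, φ x = (h.appLE U ⊤ (by subst hU; simp) ≫ (Scheme.ΓSpecIso (CommRingCat.of R)).hom) x := by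
  have hU' : U = h ''ᵁ ⊤ := by rw [hU, Scheme.Hom.image_top_eq_opensRange]
  subst hU'
  refine ⟨(h.appIso ⊤ ≪≫ Scheme.ΓSpecIso (CommRingCat.of R)).commRingCatIsoToRingEquiv, fun x => ?_⟩
  have := Scheme.Hom.appIso_hom' h ⊤
  exact congr(($this ≫ (Scheme.ΓSpecIso (CommRingCat.of R)).hom) x)

lemma chart_res {C : Scheme.{u}} {R S : Type u} [CommRing R] [CommRing S] (h : Spec (CommRingCat.of R) ⟶ C)
    (ρ : R →+* S) (h' : Spec (CommRingCat.of S) ⟶ C) (hh : h' = Spec.map (CommRingCat.ofHom ρ) ≫ h)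
    (U V : C.Opens) (hUV : V ≤ U) (e : ⊤ ≤ h ⁻¹ᵁ U) (e' : ⊤ ≤ h' ⁻¹ᵁ V) :
    C.presheaf.map (homOfLE hUV).op ≫ h'.appLE V ⊤ e' ≫ (Scheme.ΓSpecIso (CommRingCat.of S)).hom =
      (h.appLE U ⊤ e ≫ (Scheme.ΓSpecIso (CommRingCat.of R)).hom) ≫ CommRingCat.ofHom ρ := by
  subst hh
  rw [Category.assoc, ← Scheme.ΓSpecIso_naturality, Scheme.Hom.map_appLE_assoc, ← Category.assoc]
  congr 1

lemma chart_scalar {C : Scheme.{u}} {R : Type u} [CommRing R] [Algebra k R] (h : Spec (CommRingCat.of R) ⟶ C)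
    (π : C ⟶ Spec (CommRingCat.of k)) (hh : h ≫ π = Spec.map (CommRingCat.ofHom (algebraMap k R)))
    (U : C.Opens) (e : ⊤ ≤ h ⁻¹ᵁ U) (a : k) :
    (h.appLE U ⊤ e ≫ (Scheme.ΓSpecIso (CommRingCat.of R)).hom) (scalar π U a) = algebraMap k R a := by
  have : ((Scheme.ΓSpecIso (CommRingCat.of k)).inv ≫ π.appTop ≫
    C.presheaf.map (homOfLE le_top).op) ≫ (h.appLE U ⊤ e ≫ (Scheme.ΓSpecIso (CommRingCat.of R)).hom) =
      CommRingCat.ofHom (algebraMap k R) := by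
    rw [Category.assoc, Iso.inv_comp_eq, ← Scheme.ΓSpecIso_naturality, ← hh]
    have h2 : π.appTop ≫ C.presheaf.map (homOfLE le_top).op ≫ h.appLE U ⊤ e = (h ≫ π).appTop := by
      rw [Scheme.Hom.map_appLE, Scheme.Hom.comp_appTop]
      congr 1
    rw [← h2]
    simp only [Category.assoc]
  exact congr($this a)

/-- All gluing data are realized: for every `g` and `F` there is a ribbon `C` of genus `g` with
gluing data `F`. -/
theorem exists_gluing (g : ℕ) (F : Fin (g - 2) → k) :
    ∃ (C : Scheme.{u}) (π : C ⟶ Spec (CommRingCat.of k)), Nonempty (Gluing π g F) := by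
  have a1 := isOpenImmersion_rho₁ g (tail F)
  have a2 := isOpenImmersion_rho₂ (k := k)
  obtain ⟨C, i, j, hi, hj, hp, hc, hm⟩ := exists_pushout (Spec.map (CommRingCat.ofHom (rho₁ g (tail F)).toRingHom))
    (Spec.map (CommRingCat.ofHom (rho₂ (k := k)).toRingHom))
  let π : C ⟶ Spec (CommRingCat.of k) := hp.desc
    (Spec.map (CommRingCat.ofHom (algebraMap k (DualNumber k[X]))))
    (Spec.map (CommRingCat.ofHom (algebraMap k (DualNumber k[X]))))
    (by
      rw [← Spec.map_comp, ← Spec.map_comp]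
      congr 1
      refine CommRingCat.hom_ext (RingHom.ext fun a => ?_)
      exact ((rho₁ g (tail F)).commutes a).trans ((rho₂ (k := k)).commutes a).symm)
  obtain ⟨φ₁, h₁⟩ := chart i i.opensRange rfl
  obtain ⟨φ₂, h₂⟩ := chart j j.opensRange rfl
  obtain ⟨φ₁₂, h₁₂⟩ := chart (Spec.map (CommRingCat.ofHom (rho₁ g (tail F)).toRingHom) ≫ i)
    (i.opensRange ⊓ j.opensRange) hm
  refine ⟨C, π, ⟨⟨i.opensRange, j.opensRange, hc, isAffineOpen_opensRange _, isAffineOpen_opensRange _, 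
    hm ▸ isAffineOpen_opensRange _, φ₁, φ₂, φ₁₂, ?_, ?_, ?_, ?_⟩⟩⟩
  · intro a
    rw [h₁]
    exact chart_scalar i π (hp.inl_desc _ _ _) _ _ a
  · intro a
    rw [h₂]
    exact chart_scalar j π (hp.inr_desc _ _ _) _ _ a
  · intro f
    rw [h₁₂, h₁]
    exact congr($(chart_res (R := DualNumber k[X]) (S := DualNumber k[T;T⁻¹]) i (rho₁ g (tail F)).toRingHom _ rfl _ _ inf_le_left _ _) f)
  · intro f
    rw [h₁₂, h₂]
    exact congr($(chart_res (R := DualNumber k[X]) (S := DualNumber k[T;T⁻¹]) j (rho₂ (k := k)).toRingHom _ hp.w _ _ inf_le_right _ _) f)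

end Existence

end Ribbon

end

/-! Classification. A line bundle is free on each chart, because the chart ring is `A[ε]/ε²` with `A
= k[X]` Euclidean (`exists_frame_of_affine`). It is therefore a unit `u` of `k[t, t⁻¹, η]/η²`, taken
modulo units of the two charts (`nonempty_iso_glueModule`). The reduction of `u` is `c t^m`.
Splitting off `c (t + Fη)^m` leaves `1 + Bη`, and the chart units `1 + aε`, `1 + bη` move `B` by
`a(t⁻¹) t^{-g-1}` and `b(t)`. Exactly the coefficients of `t⁻¹, …, t^{-g}` in `B` survive: they form
a class in `H¹(ℙ¹, 𝒪(-g-1)) = k^g`, and these are the coordinates `G` (`exists_transition`,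
`transition_injective`).

Cohomology. The nilradical filters the bundle, with sub `𝒪(m-g-1)` and quotient `𝒪(m)` on `ℙ¹`, so
the Čech differential is block triangular and everything is governed by the connecting map `δ :
H⁰(𝒪(m)) → H¹(𝒪(m-g-1))`. The rank of `δ` cancels in `χ = 2m + 1 - g` (`index_cech`), so the degree
is `2m`, and degree `2n` means `m = n`. Since `n ≤ g`, the sub has no sections and `H⁰(L) = ker δ`.
The section `t^l` of `𝒪(n)` lifts over `U₁` to `s^{n-l} e₁ = (t + Fη)^l (1 + Gη) e₂`, whose
`η`-coefficient is `t^l G + l t^{l-1} F`. Its coefficients at `t⁻¹, …, t^{-(g-n)}` are column `l +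
1` of `A_F(G)` (`connecting_transition`). Hence `h⁰(L) + rank A_F(G) = n + 1`
(`HasCoordinates.h0_add_rank`), which turns the condition on `h⁰` into a rank condition, cut out by
minors. -/

noncomputable section

namespace Ribbon

/-! ## Sections, frames and gluing -/

section Sections

variable {C : Scheme.{u}}

/-- Restriction of functions on a scheme. -/
def fres {U V : C.Opens} (h : V ≤ U) : Γ(C, U) →+* Γ(C, V) :=
  (C.presheaf.map (homOfLE h).op).hom

lemma fres_fres {U V W : C.Opens} (h : V ≤ U) (h' : W ≤ V) (f : Γ(C, U)) :
    fres h' (fres h f) = fres (h'.trans h) f := by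
  change (C.presheaf.map (homOfLE h).op ≫ C.presheaf.map (homOfLE h').op) f = _
  rw [← Functor.map_comp]
  rfl

lemma fres_self {U : C.Opens} (h : U ≤ U) (f : Γ(C, U)) : fres h f = f := by
  change C.presheaf.map (𝟙 _) f = f
  rw [CategoryTheory.Functor.map_id]
  rfl

lemma fres_bijective {U V : C.Opens} (h : V ≤ U) (h' : U ≤ V) :
    Function.Bijective (fres h) :=
  Function.bijective_iff_has_inverse.mpr ⟨fres h', fun f => by rw [fres_fres, fres_self],
    fun f => by rw [fres_fres, fres_self]⟩

lemma fres_ext {ι : Type*} {U : C.Opens} (V : ι → C.Opens) (h : ∀ i, V i ≤ U)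
    (hU : U ≤ iSup V) {f f' : Γ(C, U)} (hf : ∀ i, fres (h i) f = fres (h i) f') : f = f' :=
  C.sheaf.eq_of_locally_eq' V U (fun i => homOfLE (h i)) hU f f' hf

lemma exists_fres {ι : Type*} {U : C.Opens} (V : ι → C.Opens) (h : ∀ i, V i ≤ U)
    (hU : U ≤ iSup V) (f : ∀ i, Γ(C, V i))
    (hf : ∀ i j, fres (inf_le_left : V i ⊓ V j ≤ V i) (f i) = fres inf_le_right (f j)) :
    ∃ s : Γ(C, U), ∀ i, fres (h i) s = f i :=
  (C.sheaf.existsUnique_gluing' V U (fun i => homOfLE (h i)) hU f hf).exists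

lemma le_iSup_cond {U V W : C.Opens} (h : W ≤ U ⊔ V) :
    W ≤ ⨆ b : Bool, cond b U V := by
  rwa [iSup_bool_eq]

variable {L : C.Modules}

lemma res_res {U V W : C.Opens} (h : V ≤ U) (h' : W ≤ V) (x : Γ(L, U)) :
    res L h' (res L h x) = res L (h'.trans h) x := by
  change (L.presheaf.map (homOfLE h).op ≫ L.presheaf.map (homOfLE h').op) x = _
  rw [← Functor.map_comp]
  rfl

lemma res_self {U : C.Opens} (h : U ≤ U) (x : Γ(L, U)) : res L h x = x := by
  change L.presheaf.map (𝟙 _) x = x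
  rw [CategoryTheory.Functor.map_id]
  rfl

lemma res_add {U V : C.Opens} (h : V ≤ U) (x y : Γ(L, U)) :
    res L h (x + y) = res L h x + res L h y :=
  map_add (L.presheaf.map (homOfLE h).op).hom x y

lemma res_smul {U V : C.Opens} (h : V ≤ U) (f : Γ(C, U)) (x : Γ(L, U)) :
    res L h (f • x) = fres h f • res L h x :=
  Scheme.Modules.map_smul L (homOfLE h) f x

lemma res_ext {ι : Type*} {U : C.Opens} (V : ι → C.Opens) (h : ∀ i, V i ≤ U)
    (hU : U ≤ iSup V) {x y : Γ(L, U)} (hx : ∀ i, res L (h i) x = res L (h i) y) : x = y :=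
  TopCat.Sheaf.eq_of_locally_eq' ⟨L.presheaf, L.isSheaf⟩ V U (fun i => homOfLE (h i)) hU x y hx

lemma exists_res {ι : Type*} {U : C.Opens} (V : ι → C.Opens) (h : ∀ i, V i ≤ U)
    (hU : U ≤ iSup V) (x : ∀ i, Γ(L, V i))
    (hx : ∀ i j, res L (inf_le_left : V i ⊓ V j ≤ V i) (x i) = res L inf_le_right (x j)) :
    ∃ s : Γ(L, U), ∀ i, res L (h i) s = x i :=
  (TopCat.Sheaf.existsUnique_gluing' ⟨L.presheaf, L.isSheaf⟩ V U
    (fun i => homOfLE (h i)) hU x hx).exists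

lemma res_ext₂ {U V W : C.Opens} (hU : U ≤ W) (hV : V ≤ W) (hW : W ≤ U ⊔ V) {x y : Γ(L, W)}
    (h₁ : res L hU x = res L hU y) (h₂ : res L hV x = res L hV y) : x = y :=
  res_ext (fun b : Bool => cond b U V) (fun b => by cases b <;> assumption) (le_iSup_cond hW)
    (fun b => by cases b <;> assumption)

lemma exists_res₂ {U V W : C.Opens} (hU : U ≤ W) (hV : V ≤ W) (hW : W ≤ U ⊔ V)
    (x : Γ(L, U)) (y : Γ(L, V))
    (h : res L (inf_le_left : U ⊓ V ≤ U) x = res L inf_le_right y) :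
    ∃ s : Γ(L, W), res L hU s = x ∧ res L hV s = y := by
  obtain ⟨s, hs⟩ := exists_res (L := L) (fun b : Bool => cond b U V)
    (fun b => by cases b <;> assumption) (le_iSup_cond hW)
    (fun b => match b with | true => x | false => y) (by
      rintro (_ | _) (_ | _)
      · rfl
      · have := congrArg (res L (le_of_eq (inf_comm V U))) h
        rw [res_res, res_res] at this
        exact this.symm
      · exact h
      · rfl)
  exact ⟨s, hs true, hs false⟩

lemma fres_ext₂ {U V W : C.Opens} (hU : U ≤ W) (hV : V ≤ W) (hW : W ≤ U ⊔ V) {x y : Γ(C, W)}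
    (h₁ : fres hU x = fres hU y) (h₂ : fres hV x = fres hV y) : x = y :=
  fres_ext (fun b : Bool => cond b U V) (fun b => by cases b <;> assumption) (le_iSup_cond hW)
    (fun b => by cases b <;> assumption)

lemma exists_fres₂ {U V W : C.Opens} (hU : U ≤ W) (hV : V ≤ W) (hW : W ≤ U ⊔ V)
    (x : Γ(C, U)) (y : Γ(C, V))
    (h : fres (inf_le_left : U ⊓ V ≤ U) x = fres inf_le_right y) :
    ∃ s : Γ(C, W), fres hU s = x ∧ fres hV s = y := by
  obtain ⟨s, hs⟩ := exists_fres (fun b : Bool => cond b U V)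
    (fun b => by cases b <;> assumption) (le_iSup_cond hW)
    (fun b => match b with | true => x | false => y) (by
      rintro (_ | _) (_ | _)
      · rfl
      · have := congrArg (fres (le_of_eq (inf_comm V U))) h
        rw [fres_fres, fres_fres] at this
        exact this.symm
      · exact h
      · rfl)
  exact ⟨s, hs true, hs false⟩

lemma app_res {M : C.Modules} (φ : L ⟶ M) {U V : C.Opens} (h : V ≤ U) (x : Γ(L, U)) :
    φ.app V (res L h x) = res M h (φ.app U x) :=
  congr($(φ.mapPresheaf.naturality (homOfLE h).op) x)

/-! ### Frames: coordinates, change of frame, gluing. -/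

namespace IsFrame

variable {U : C.Opens} {e : Γ(L, U)}

lemma of_le (he : IsFrame L U e) {V : C.Opens} (h : V ≤ U) : IsFrame L V (res L h e) := by
  intro W hW
  simp only [res_res]
  exact he W _

lemma smul_unit (he : IsFrame L U e) (f : Γ(C, U)ˣ) : IsFrame L U ((f : Γ(C, U)) • e) := by
  intro V h
  have h1 := (he V h).comp (((Units.map (fres h : Γ(C, U) →* Γ(C, V)) f)).mulRight_bijective)
  refine (congrArg Function.Bijective (funext fun x => ?_)).mp h1
  simp [res_smul, mul_smul]

/-- The frame coordinate of a section. -/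
def coord (he : IsFrame L U e) {V : C.Opens} (h : V ≤ U) : Γ(L, V) ≃+ Γ(C, V) :=
  (AddEquiv.ofBijective
    (AddMonoidHom.mk' (fun f : Γ(C, V) => f • res L h e) fun f f' => add_smul f f' _)
    (he V h)).symm

lemma coord_smul_res (he : IsFrame L U e) {V : C.Opens} (h : V ≤ U) (x : Γ(L, V)) :
    he.coord h x • res L h e = x :=
  AddEquiv.apply_symm_apply (he.coord h).symm x

lemma coord_eq_iff (he : IsFrame L U e) {V : C.Opens} (h : V ≤ U) {x : Γ(L, V)} {f : Γ(C, V)} :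
    he.coord h x = f ↔ x = f • res L h e := by
  rw [← AddEquiv.eq_symm_apply]
  rfl

lemma coord_smul (he : IsFrame L U e) {V : C.Opens} (h : V ≤ U) (f : Γ(C, V)) (x : Γ(L, V)) :
    he.coord h (f • x) = f * he.coord h x := by
  rw [coord_eq_iff, mul_smul, coord_smul_res]

lemma coord_res (he : IsFrame L U e) {V W : C.Opens} (h : V ≤ U) (h' : W ≤ V) (x : Γ(L, V)) :
    he.coord (h'.trans h) (res L h' x) = fres h' (he.coord h x) := by
  rw [coord_eq_iff, ← res_res h h', ← res_smul, coord_smul_res]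

lemma exists_unit (he : IsFrame L U e) {e' : Γ(L, U)} (he' : IsFrame L U e') :
    ∃ f : Γ(C, U)ˣ, e' = (f : Γ(C, U)) • e := by
  have h1 := he.coord_smul_res le_rfl e'
  have h2 := he'.coord_smul_res le_rfl e
  rw [res_self] at h1 h2
  have inj : ∀ {e : Γ(L, U)}, IsFrame L U e → ∀ {a b : Γ(C, U)}, a • e = b • e → a = b := by
    intro e he a b hab
    apply (he U le_rfl).injective
    simpa only [res_self] using hab
  refine ⟨⟨he.coord le_rfl e', he'.coord le_rfl e, inj he' ?_, inj he ?_⟩, h1.symm⟩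
  · rw [mul_smul, h2, h1, one_smul]
  · rw [mul_smul, h1, h2, one_smul]

/-- A section which restricts to frames on the members of a cover of `U` is a frame on `U`. -/
lemma of_cover₂ {V W : C.Opens} (hV : V ≤ U) (hW : W ≤ U) (hU : U ≤ V ⊔ W)
    (h₁ : IsFrame L V (res L hV e)) (h₂ : IsFrame L W (res L hW e)) : IsFrame L U e := by
  intro O hO
  have hc : O ≤ (O ⊓ V) ⊔ (O ⊓ W) := by
    rw [← inf_sup_left]; exact le_inf le_rfl (hO.trans hU)
  constructor
  · intro f f' hf
    refine fres_ext₂ inf_le_left inf_le_left hc ((h₁ _ inf_le_right).injective ?_)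
      ((h₂ _ inf_le_right).injective ?_)
    · have := congrArg (res L (inf_le_left : O ⊓ V ≤ O)) hf
      simpa only [res_smul, res_res] using this
    · have := congrArg (res L (inf_le_left : O ⊓ W ≤ O)) hf
      simpa only [res_smul, res_res] using this
  · intro x
    obtain ⟨a, ha⟩ := (h₁ (O ⊓ V) inf_le_right).surjective (res L inf_le_left x)
    obtain ⟨b, hb⟩ := (h₂ (O ⊓ W) inf_le_right).surjective (res L inf_le_left x)
    simp only [res_res] at ha hb
    obtain ⟨s, hs₁, hs₂⟩ := exists_fres₂ inf_le_left inf_le_left hc a b (by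
      refine (h₁ ((O ⊓ V) ⊓ (O ⊓ W)) (inf_le_left.trans inf_le_right)).injective ?_
      have ha' := congrArg (res L (inf_le_left : (O ⊓ V) ⊓ (O ⊓ W) ≤ _)) ha
      have hb' := congrArg (res L (inf_le_right : (O ⊓ V) ⊓ (O ⊓ W) ≤ _)) hb
      simp only [res_smul, res_res] at ha' hb' ⊢
      rw [ha', hb'])
    refine ⟨s, res_ext₂ inf_le_left inf_le_left hc ?_ ?_⟩
    · simp only [res_smul, res_res, hs₁, ha]
    · simp only [res_smul, res_res, hs₂, hb]

/-- Frames which agree up to multiplicatively split units glue. -/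
lemma exists_of_split {V W : C.Opens} {e : Γ(L, V)} {e' : Γ(L, W)} (he : IsFrame L V e)
    (he' : IsFrame L W e')
    (h : ∀ w : Γ(C, V ⊓ W)ˣ, ∃ (a : Γ(C, V)ˣ) (b : Γ(C, W)ˣ),
      fres (inf_le_left : V ⊓ W ≤ V) (a : Γ(C, V)) * fres (inf_le_right : V ⊓ W ≤ W) (b : Γ(C, W)) =
        w) :
    ∃ s : Γ(L, V ⊔ W), IsFrame L (V ⊔ W) s := by
  obtain ⟨w, hw⟩ := (he.of_le (inf_le_left : V ⊓ W ≤ V)).exists_unit (he'.of_le inf_le_right)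
  obtain ⟨a, b, hab⟩ := h w
  -- On the overlap `e' = w e` with `w = a b`, so `a e` and `b⁻¹ e'` agree there.
  obtain ⟨s, hs₁, hs₂⟩ := exists_res₂ (L := L) le_sup_left le_sup_right (le_refl (V ⊔ W))
    ((a : Γ(C, V)) • e) (((b⁻¹ : Γ(C, W)ˣ) : Γ(C, W)) • e') (by
      rw [res_smul, res_smul, hw, ← hab, smul_smul, mul_left_comm, ← map_mul, Units.inv_mul,
        map_one, mul_one])
  exact ⟨s, of_cover₂ le_sup_left le_sup_right le_rfl (hs₁ ▸ he.smul_unit a)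
    (hs₂ ▸ he'.smul_unit b⁻¹)⟩

/-- Isomorphisms of modules preserve frames. -/
lemma map_iso {M : C.Modules} (he : IsFrame L U e) (φ : L ≅ M) :
    IsFrame M U (φ.hom.app U e) := by
  intro V h
  have h1 : Function.Bijective (φ.hom.app V) := by
    have : IsIso (φ.hom.app V) := inferInstance
    exact ConcreteCategory.bijective_of_isIso (φ.hom.app V)
  refine (congrArg Function.Bijective (funext fun x => ?_)).mp (h1.comp (he V h))
  simp only [Function.comp_apply, Scheme.Modules.Hom.app_smul, app_res]

end IsFrame

end Sections

/-! ## The line bundle with a given transition function -/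

section Model

variable {C : Scheme.{u}} {U₁ U₂ : C.Opens}

/-- The sections over `V` of the module glued from `𝒪_{U₁}` and `𝒪_{U₂}` along multiplication
by `w`: the pairs `(a, b)` with `a w = b` on `V ∩ U₁ ∩ U₂`. -/
def glueSections (w : Γ(C, U₁ ⊓ U₂)) (V : C.Opens) :
    AddSubgroup (Γ(C, V ⊓ U₁) × Γ(C, V ⊓ U₂)) where
  carrier := {p | fres (inf_le_inf_left V inf_le_left) p.1 *
    fres (inf_le_right : V ⊓ (U₁ ⊓ U₂) ≤ _) w = fres (inf_le_inf_left V inf_le_right) p.2}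
  add_mem' := by
    intro p q hp hq
    simp only [Set.mem_ofPred_eq, Prod.fst_add, Prod.snd_add, map_add, add_mul] at *
    rw [hp, hq]
  zero_mem' := by simp
  neg_mem' := by
    intro p hp
    simp only [Set.mem_ofPred_eq, Prod.fst_neg, Prod.snd_neg, map_neg, neg_mul, neg_inj] at *
    exact hp

lemma mem_glueSections {w : Γ(C, U₁ ⊓ U₂)} {V : C.Opens} {p : Γ(C, V ⊓ U₁) × Γ(C, V ⊓ U₂)} :
    p ∈ glueSections w V ↔ fres (inf_le_inf_left V inf_le_left) p.1 *
      fres (inf_le_right : V ⊓ (U₁ ⊓ U₂) ≤ _) w = fres (inf_le_inf_left V inf_le_right) p.2 :=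
  Iff.rfl

/-- Restriction of sections of a glued module. -/
def glueRes (w : Γ(C, U₁ ⊓ U₂)) {V W : C.Opens} (h : W ≤ V) :
    glueSections w V →+ glueSections w W where
  toFun p := ⟨(fres (inf_le_inf_right U₁ h) p.1.1, fres (inf_le_inf_right U₂ h) p.1.2), by
    have := congrArg (fres (inf_le_inf_right (U₁ ⊓ U₂) h)) p.2
    simp only [map_mul, fres_fres] at this
    simpa only [mem_glueSections, fres_fres] using this⟩
  map_zero' := by ext <;> simp
  map_add' p q := by ext <;> simp

lemma glueRes_self (w : Γ(C, U₁ ⊓ U₂)) {V : C.Opens} (h : V ≤ V) (p : glueSections w V) :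
    glueRes w h p = p :=
  Subtype.ext (Prod.ext (fres_self (inf_le_inf_right U₁ h) p.1.1)
    (fres_self (inf_le_inf_right U₂ h) p.1.2))

lemma glueRes_glueRes (w : Γ(C, U₁ ⊓ U₂)) {V W O : C.Opens} (h : W ≤ V) (h' : O ≤ W)
    (p : glueSections w V) : glueRes w h' (glueRes w h p) = glueRes w (h'.trans h) p :=
  Subtype.ext (Prod.ext
    (fres_fres (inf_le_inf_right U₁ h) (inf_le_inf_right U₁ h') p.1.1)
    (fres_fres (inf_le_inf_right U₂ h) (inf_le_inf_right U₂ h') p.1.2))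

/-- The presheaf of abelian groups underlying a glued module. -/
def gluePresheaf (w : Γ(C, U₁ ⊓ U₂)) : TopCat.Presheaf Ab.{u} C where
  obj V := AddCommGrpCat.of (glueSections w V.unop)
  map i := AddCommGrpCat.ofHom (glueRes w i.unop.le)
  map_id V := by
    refine ConcreteCategory.hom_ext _ _ fun p => ?_
    exact glueRes_self w le_rfl p
  map_comp i j := by
    refine ConcreteCategory.hom_ext _ _ fun p => ?_
    exact (glueRes_glueRes w i.unop.le j.unop.le p).symm

instance (w : Γ(C, U₁ ⊓ U₂)) (V : C.Opens) : Module Γ(C, V) (glueSections w V) where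
  smul f p := ⟨(fres inf_le_left f * p.1.1, fres inf_le_left f * p.1.2), by
    have := p.2
    rw [mem_glueSections] at this ⊢
    simp only [map_mul, fres_fres, ← this, mul_assoc]⟩
  one_smul p := Subtype.ext (Prod.ext (by change fres _ 1 * _ = _; simp)
    (by change fres _ 1 * _ = _; simp))
  mul_smul f f' p := Subtype.ext (Prod.ext
    (by change fres _ (f * f') * _ = fres _ f * (fres _ f' * _); rw [map_mul, mul_assoc])
    (by change fres _ (f * f') * _ = fres _ f * (fres _ f' * _); rw [map_mul, mul_assoc]))
  smul_zero f := Subtype.ext (Prod.ext (mul_zero _) (mul_zero _))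
  smul_add f p q := Subtype.ext (Prod.ext (mul_add _ _ _) (mul_add _ _ _))
  add_smul f f' p := Subtype.ext (Prod.ext
    (by change fres _ (f + f') * _ = fres _ f * _ + fres _ f' * _; rw [map_add, add_mul])
    (by change fres _ (f + f') * _ = fres _ f * _ + fres _ f' * _; rw [map_add, add_mul]))
  zero_smul p := Subtype.ext (Prod.ext (by change fres _ 0 * _ = 0; simp)
    (by change fres _ 0 * _ = 0; simp))

lemma glueRes_smul (w : Γ(C, U₁ ⊓ U₂)) {V W : C.Opens} (h : W ≤ V) (f : Γ(C, V))
    (p : glueSections w V) : glueRes w h (f • p) = fres h f • glueRes w h p :=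
  Subtype.ext (Prod.ext
    (by
      change fres _ (fres _ f * _) = fres _ (fres _ f) * fres _ _
      rw [map_mul, fres_fres, fres_fres])
    (by
      change fres _ (fres _ f * _) = fres _ (fres _ f) * fres _ _
      rw [map_mul, fres_fres, fres_fres]))

/-- The two components glue separately because `𝒪_C` is a sheaf, and the relation `a w = b` may be
checked on the members of the cover. -/
lemma gluePresheaf_isSheaf (w : Γ(C, U₁ ⊓ U₂)) : (gluePresheaf w).IsSheaf := by
  rw [TopCat.Presheaf.isSheaf_iff_isSheafUniqueGluing]
  intro ι V s hs
  have hs₁ : ∀ i j, glueRes w (inf_le_left : V i ⊓ V j ≤ V i) (s i) =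
      glueRes w inf_le_right (s j) := hs
  have hc : ∀ O : C.Opens, iSup V ⊓ O ≤ ⨆ i, V i ⊓ O := fun O => (iSup_inf_eq V O).le
  have hle : ∀ O i, V i ⊓ O ≤ iSup V ⊓ O := fun O i => inf_le_inf_right O (le_iSup V i)
  obtain ⟨a, ha⟩ := exists_fres (fun i => V i ⊓ U₁) (hle U₁) (hc U₁) (fun i => (s i).1.1) (by
    intro i j
    have := congrArg (fun p => fres (le_inf (inf_le_inf inf_le_left inf_le_left)
      (inf_le_left.trans inf_le_right) : V i ⊓ U₁ ⊓ (V j ⊓ U₁) ≤ V i ⊓ V j ⊓ U₁) p.1.1) (hs₁ i j)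
    simp only [glueRes, AddMonoidHom.coe_mk, ZeroHom.coe_mk, fres_fres] at this
    exact this)
  obtain ⟨b, hb⟩ := exists_fres (fun i => V i ⊓ U₂) (hle U₂) (hc U₂) (fun i => (s i).1.2) (by
    intro i j
    have := congrArg (fun p => fres (le_inf (inf_le_inf inf_le_left inf_le_left)
      (inf_le_left.trans inf_le_right) : V i ⊓ U₂ ⊓ (V j ⊓ U₂) ≤ V i ⊓ V j ⊓ U₂) p.1.2) (hs₁ i j)
    simp only [glueRes, AddMonoidHom.coe_mk, ZeroHom.coe_mk, fres_fres] at this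
    exact this)
  refine ⟨⟨(a, b), ?_⟩, ?_, ?_⟩
  · rw [mem_glueSections]
    refine fres_ext (fun i => V i ⊓ (U₁ ⊓ U₂)) (hle _) (hc _) fun i => ?_
    have h1 := congrArg (fres (inf_le_inf_left (V i) (inf_le_left : U₁ ⊓ U₂ ≤ _))) (ha i)
    have h2 := congrArg (fres (inf_le_inf_left (V i) (inf_le_right : U₁ ⊓ U₂ ≤ _))) (hb i)
    have h3 := (s i).2
    rw [mem_glueSections] at h3
    simp only [map_mul, fres_fres] at h1 h2 ⊢
    rw [h1, h2, h3]
  · intro i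
    exact Subtype.ext (Prod.ext (ha i) (hb i))
  · intro p hp
    have hp' : ∀ i, glueRes w (le_iSup V i) p = s i := hp
    refine Subtype.ext (Prod.ext ?_ ?_)
    · refine fres_ext (fun i => V i ⊓ U₁) (hle _) (hc _) fun i => ?_
      exact (congrArg (fun p => p.1.1) (hp' i)).trans (ha i).symm
    · refine fres_ext (fun i => V i ⊓ U₂) (hle _) (hc _) fun i => ?_
      exact (congrArg (fun p => p.1.2) (hp' i)).trans (hb i).symm

instance (w : Γ(C, U₁ ⊓ U₂)) (V : (Opens C)ᵒᵖ) :
    Module (C.ringCatSheaf.obj.obj V) ((gluePresheaf w).obj V) :=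
  inferInstanceAs (Module Γ(C, V.unop) (glueSections w V.unop))

/-- The `𝒪_C`-module obtained by gluing `𝒪_{U₁}` and `𝒪_{U₂}` along multiplication by `w`. -/
def glueModule (w : Γ(C, U₁ ⊓ U₂)) : C.Modules :=
  (⟨PresheafOfModules.ofPresheaf (R := C.ringCatSheaf.obj) (gluePresheaf w)
    (fun _ _ i f p => glueRes_smul w i.unop.le f p), gluePresheaf_isSheaf w⟩ :
      SheafOfModules C.ringCatSheaf)

/-- The generator over `U₁` of a glued module. -/
def glueFrame₁ (w : Γ(C, U₁ ⊓ U₂)) : Γ(glueModule w, U₁) :=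
  (⟨(1, w), by rw [mem_glueSections, map_one, one_mul]⟩ : glueSections w U₁)

/-- The generator over `U₂` of a glued module. -/
def glueFrame₂ (w : Γ(C, U₁ ⊓ U₂)ˣ) : Γ(glueModule (w : Γ(C, U₁ ⊓ U₂)), U₂) :=
  (⟨(fres (le_of_eq (inf_comm U₂ U₁)) ((w⁻¹ : Γ(C, U₁ ⊓ U₂)ˣ) : Γ(C, U₁ ⊓ U₂)), 1), by
    rw [mem_glueSections, map_one, fres_fres, ← map_mul, Units.inv_mul, map_one]⟩ :
      glueSections (w : Γ(C, U₁ ⊓ U₂)) U₂)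

/-- For `V ⊆ U₁` one has `V ∩ U₁ = V`, so the first component is an arbitrary function on `V`, and
the relation `a w = b` forces the second. This half works for any `w`; only the frame over `U₂`
needs `w` invertible. -/
lemma isFrame_glueFrame₁ (w : Γ(C, U₁ ⊓ U₂)) :
    IsFrame (glueModule w) U₁ (glueFrame₁ w) := by
  intro V h
  have key : ∀ f : Γ(C, V), (f • res (glueModule w) h (glueFrame₁ w) : glueSections w V).1 =
      (fres inf_le_left f, fres inf_le_left f * fres (inf_le_inf_right U₂ h) w) := fun f =>
    Prod.ext ((congrArg (fres inf_le_left f * ·) (map_one (fres _))).trans (mul_one _)) rfl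
  constructor
  · intro f f' hf
    have hf' := congrArg (fun p : glueSections w V => p.1.1) hf
    simp only [key] at hf'
    exact (fres_bijective inf_le_left (le_inf le_rfl h)).injective hf'
  · intro p
    change glueSections w V at p
    obtain ⟨f, hf⟩ := (fres_bijective (inf_le_left : V ⊓ U₁ ≤ V) (le_inf le_rfl h)).surjective p.1.1
    refine ⟨f, Subtype.ext ((key f).trans (Prod.ext hf ?_))⟩
    refine (fres_bijective (inf_le_inf_left V inf_le_right : V ⊓ (U₁ ⊓ U₂) ≤ V ⊓ U₂)
      (le_inf inf_le_left (inf_le_inf_right U₂ h))).injective ?_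
    have hp := p.2
    rw [mem_glueSections, ← hf] at hp
    simp only [map_mul, fres_fres] at hp ⊢
    exact hp

lemma isFrame_glueFrame₂ (w : Γ(C, U₁ ⊓ U₂)ˣ) :
    IsFrame (glueModule (w : Γ(C, U₁ ⊓ U₂))) U₂ (glueFrame₂ w) := by
  intro V h
  have hV : V ⊓ U₁ ≤ U₁ ⊓ U₂ := le_inf inf_le_right (inf_le_left.trans h)
  have key : ∀ f : Γ(C, V),
      (f • res (glueModule (w : Γ(C, U₁ ⊓ U₂))) h (glueFrame₂ w) : glueSections _ V).1 =
      (fres inf_le_left f * fres hV ((w⁻¹ : Γ(C, U₁ ⊓ U₂)ˣ) : Γ(C, U₁ ⊓ U₂)),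
        fres inf_le_left f) := fun f =>
    Prod.ext (congrArg (fres inf_le_left f * ·) (fres_fres _ _ _))
      ((congrArg (fres inf_le_left f * ·) (map_one (fres _))).trans (mul_one _))
  constructor
  · intro f f' hf
    have hf' := congrArg (fun p : glueSections _ V => p.1.2) hf
    simp only [key] at hf'
    exact (fres_bijective inf_le_left (le_inf le_rfl h)).injective hf'
  · intro p
    change glueSections _ V at p
    obtain ⟨f, hf⟩ := (fres_bijective (inf_le_left : V ⊓ U₂ ≤ V) (le_inf le_rfl h)).surjective p.1.2
    refine ⟨f, Subtype.ext ((key f).trans (Prod.ext ?_ hf))⟩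
    refine (fres_bijective (inf_le_inf_left V inf_le_left : V ⊓ (U₁ ⊓ U₂) ≤ V ⊓ U₁)
      (le_inf inf_le_left hV)).injective ?_
    have hp := p.2
    rw [mem_glueSections, ← hf] at hp
    simp only [map_mul, fres_fres] at hp ⊢
    rw [← hp, mul_assoc, ← map_mul, Units.mul_inv, map_one, mul_one]

lemma res_glueFrame₁ (w : Γ(C, U₁ ⊓ U₂)ˣ) :
    res (glueModule (w : Γ(C, U₁ ⊓ U₂))) (inf_le_left : U₁ ⊓ U₂ ≤ U₁) (glueFrame₁ _) =
      (w : Γ(C, U₁ ⊓ U₂)) • res (glueModule (w : Γ(C, U₁ ⊓ U₂))) inf_le_right (glueFrame₂ w) := by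
  refine Subtype.ext (Prod.ext ?_ ?_)
  · change fres _ 1 = fres _ (w : Γ(C, U₁ ⊓ U₂)) * fres _ (fres _ _)
    rw [fres_fres, ← map_mul, Units.mul_inv, map_one, map_one]
  · change fres _ (w : Γ(C, U₁ ⊓ U₂)) = fres _ (w : Γ(C, U₁ ⊓ U₂)) * fres _ 1
    rw [map_one, mul_one]

variable {L : C.Modules} {e₁ : Γ(L, U₁)} {e₂ : Γ(L, U₂)}

/-- The comparison map from a module with frames over `U₁` and `U₂` to the glued module. -/
def toGlueSections (he₁ : IsFrame L U₁ e₁) (he₂ : IsFrame L U₂ e₂) {w : Γ(C, U₁ ⊓ U₂)}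
    (hw : res L (inf_le_left : U₁ ⊓ U₂ ≤ U₁) e₁ = w • res L inf_le_right e₂) (V : C.Opens) :
    Γ(L, V) →+ glueSections w V where
  toFun x := ⟨(he₁.coord inf_le_right (res L inf_le_left x),
      he₂.coord inf_le_right (res L inf_le_left x)), by
    have h1 := he₁.coord_smul_res inf_le_right (res L (inf_le_left : V ⊓ U₁ ≤ V) x)
    have h2 := congrArg (res L (inf_le_inf_left V inf_le_left : V ⊓ (U₁ ⊓ U₂) ≤ V ⊓ U₁)) h1
    have h3 := congrArg (res L (inf_le_right : V ⊓ (U₁ ⊓ U₂) ≤ U₁ ⊓ U₂)) hw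
    simp only [res_smul, res_res] at h2 h3
    rw [h3, smul_smul] at h2
    rw [mem_glueSections, eq_comm]
    simp only [← IsFrame.coord_res _ _ (inf_le_inf_left V inf_le_right)]
    rw [IsFrame.coord_eq_iff, res_res, h2]⟩
  map_zero' := Subtype.ext (Prod.ext
    (by simp [show ∀ (U : C.Opens) (h : U ≤ V), res L h 0 = 0 from fun _ _ => map_zero _])
    (by simp [show ∀ (U : C.Opens) (h : U ≤ V), res L h 0 = 0 from fun _ _ => map_zero _]))
  map_add' x y := Subtype.ext (Prod.ext (by simp [res_add]) (by simp [res_add]))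

lemma toGlueSections_smul (he₁ : IsFrame L U₁ e₁) (he₂ : IsFrame L U₂ e₂)
    {w : Γ(C, U₁ ⊓ U₂)} (hw : res L (inf_le_left : U₁ ⊓ U₂ ≤ U₁) e₁ = w • res L inf_le_right e₂)
    (V : C.Opens) (f : Γ(C, V)) (x : Γ(L, V)) :
    toGlueSections he₁ he₂ hw V (f • x) = f • toGlueSections he₁ he₂ hw V x := by
  refine Subtype.ext (Prod.ext ?_ ?_)
  · change he₁.coord _ (res L _ (f • x)) = fres _ f * he₁.coord _ (res L _ x)
    rw [res_smul, he₁.coord_smul]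
  · change he₂.coord _ (res L _ (f • x)) = fres _ f * he₂.coord _ (res L _ x)
    rw [res_smul, he₂.coord_smul]

/-- A pair `(a, b)` comes from the section glued from `a e₁` and `b e₂`; their agreement on the
overlap is precisely `a w = b`. -/
lemma toGlueSections_bijective (he₁ : IsFrame L U₁ e₁) (he₂ : IsFrame L U₂ e₂)
    {w : Γ(C, U₁ ⊓ U₂)} (hw : res L (inf_le_left : U₁ ⊓ U₂ ≤ U₁) e₁ = w • res L inf_le_right e₂)
    (hU : U₁ ⊔ U₂ = ⊤) (V : C.Opens) :
    Function.Bijective (toGlueSections he₁ he₂ hw V) := by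
  have hc : V ≤ (V ⊓ U₁) ⊔ (V ⊓ U₂) := by rw [← inf_sup_left, hU, inf_top_eq]
  constructor
  · intro x y hxy
    refine res_ext₂ inf_le_left inf_le_left hc ?_ ?_
    · exact (he₁.coord inf_le_right).injective (congrArg (fun p => p.1.1) hxy)
    · exact (he₂.coord inf_le_right).injective (congrArg (fun p => p.1.2) hxy)
  · rintro ⟨⟨a, b⟩, h⟩
    rw [mem_glueSections] at h
    obtain ⟨s, hs₁, hs₂⟩ := exists_res₂ (L := L) inf_le_left inf_le_left hc
      (a • res L inf_le_right e₁) (b • res L inf_le_right e₂) (by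
        have h' := congrArg (fres (le_inf (inf_le_left.trans inf_le_left)
          (inf_le_inf inf_le_right inf_le_right) : V ⊓ U₁ ⊓ (V ⊓ U₂) ≤ V ⊓ (U₁ ⊓ U₂))) h
        have hw' := congrArg (res L (inf_le_inf inf_le_right inf_le_right :
          V ⊓ U₁ ⊓ (V ⊓ U₂) ≤ U₁ ⊓ U₂)) hw
        simp only [map_mul, fres_fres, res_smul, res_res] at h' hw' ⊢
        rw [hw', smul_smul, h'])
    refine ⟨s, Subtype.ext (Prod.ext ?_ ?_)⟩
    · exact (he₁.coord_eq_iff _).mpr hs₁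
    · exact (he₂.coord_eq_iff _).mpr hs₂

/-- A module with frames over the members of a cover `C = U₁ ∪ U₂` is determined by the
transition function. -/
lemma nonempty_iso_glueModule (he₁ : IsFrame L U₁ e₁) (he₂ : IsFrame L U₂ e₂)
    {w : Γ(C, U₁ ⊓ U₂)} (hw : res L (inf_le_left : U₁ ⊓ U₂ ≤ U₁) e₁ = w • res L inf_le_right e₂)
    (hU : U₁ ⊔ U₂ = ⊤) : Nonempty (L ≅ glueModule w) := by
  let ψ : L.presheaf ⟶ (glueModule w).presheaf :=
    { app := fun V => AddCommGrpCat.ofHom (toGlueSections he₁ he₂ hw V.unop)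
      naturality := by
        intro V W i
        refine ConcreteCategory.hom_ext _ _ fun x => ?_
        refine Subtype.ext (Prod.ext ?_ ?_)
        · change he₁.coord _ (res L _ (res L i.unop.le x)) = fres _ (he₁.coord _ _)
          rw [← he₁.coord_res, res_res, res_res]
        · change he₂.coord _ (res L _ (res L i.unop.le x)) = fres _ (he₂.coord _ _)
          rw [← he₂.coord_res, res_res, res_res] }
  let φ : L ⟶ glueModule w := (⟨PresheafOfModules.homMk ψ (by
    intro V f x
    exact toGlueSections_smul he₁ he₂ hw V.unop f x)⟩ : SheafOfModules.Hom L (glueModule w))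
  have : IsIso φ := by
    rw [Scheme.Modules.Hom.isIso_iff_isIso_app]
    intro V
    rw [ConcreteCategory.isIso_iff_bijective]
    exact toGlueSections_bijective he₁ he₂ hw hU V
  exact ⟨asIso φ⟩

end Model

/-! ## Line bundles on an affine open with coordinate ring `k[x, ε]/ε²` -/

section Trivial

/-- If `f` and `g` are nonzero then `a (f g)^M = P g^{2M} + Q f^{2M}` is solvable. -/
lemma exists_split_numerator {A : Type*} [EuclideanDomain A] {f : A} (g : A)
    (hf : f ≠ 0) (M : ℕ) (a : A) :
    ∃ P Q : A, a * (f * g) ^ M = P * (g ^ M) ^ 2 + Q * (f ^ M) ^ 2 := by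
  classical
  -- This is the vanishing of `H¹(𝒪)` for the cover of `D(gcd)` by `D(f)` and `D(g)`. With `f = d
  -- f₁` and `g = d g₁`, all terms carry the factor `d^{2M}`, and what remains is a Bézout relation
  -- between `g₁^M` and `f₁^M`, multiplied by `a f₁^M g₁^M`.
  have hc : IsCoprime (g / EuclideanDomain.gcd g f) (f / EuclideanDomain.gcd g f) :=
    letI := EuclideanDomain.gcdMonoid A
    isCoprime_div_gcd_div_gcd hf
  have hg : EuclideanDomain.gcd g f * (g / EuclideanDomain.gcd g f) = g :=
    EuclideanDomain.mul_div_cancel' (fun h => hf (EuclideanDomain.gcd_eq_zero_iff.mp h).2)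
      (EuclideanDomain.gcd_dvd_left g f)
  have hf' : EuclideanDomain.gcd g f * (f / EuclideanDomain.gcd g f) = f :=
    EuclideanDomain.mul_div_cancel' (fun h => hf (EuclideanDomain.gcd_eq_zero_iff.mp h).2)
      (EuclideanDomain.gcd_dvd_right g f)
  generalize EuclideanDomain.gcd g f = d at *
  generalize g / d = g₁ at *
  generalize f / d = f₁ at *
  obtain ⟨x, y, hxy⟩ := hc.pow (m := M) (n := M)
  refine ⟨a * x * f₁ ^ M, a * y * g₁ ^ M, ?_⟩
  rw [← hg, ← hf']
  simp only [mul_pow]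
  linear_combination (-(a * (d ^ M) ^ 2 * f₁ ^ M * g₁ ^ M)) * hxy

variable {A : Type*} [EuclideanDomain A]

lemma isUnit_one_add_map_inr_mul {T : Type*} [CommRing T] (l : DualNumber A →+* T) (p : A) (t : T) :
    IsUnit (1 + l (TrivSqZeroExt.inr p) * t) := by
  refine IsUnit.of_mul_eq_one (1 - l (TrivSqZeroExt.inr p) * t) ?_
  have : l (TrivSqZeroExt.inr p) * l (TrivSqZeroExt.inr p) = 0 := by
    rw [← map_mul, TrivSqZeroExt.inr_mul_inr, map_zero]
  linear_combination (-t ^ 2) * this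

/-- Units of the localization of `A[ε]/ε²` at `f g` split into a unit of the localization at `f` and
a unit of the localization at `g`. -/
lemma exists_split_unit {f g : A} (hf : f ≠ 0) (hg : g ≠ 0) {S S' Q : Type*} [CommRing S]
    [CommRing S'] [CommRing Q] (i : DualNumber A →+* S) (i' : DualNumber A →+* S')
    (j : S →+* Q) (j' : S' →+* Q) (hj : ∀ r, j (i r) = j' (i' r))
    (hi : IsUnit (i (TrivSqZeroExt.inl f))) (hi' : IsUnit (i' (TrivSqZeroExt.inl g)))
    (hsurj : ∀ w : Q, ∃ (N : ℕ) (r : DualNumber A),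
      w * j (i (TrivSqZeroExt.inl (f * g))) ^ N = j (i r))
    (hinj : ∀ r : DualNumber A, j (i r) = 0 → ∃ N : ℕ, TrivSqZeroExt.inl (f * g) ^ N * r = 0)
    (w : Qˣ) : ∃ (a : Sˣ) (b : S'ˣ), j a * j' b = w := by
  obtain ⟨N, r, hr⟩ := hsurj w
  obtain ⟨N', r', hr'⟩ := hsurj (w⁻¹ : Qˣ)
  -- After clearing denominators in `w` and `w⁻¹`, the equation `w w⁻¹ = 1` holds in `A[ε]/ε²` up to
  -- a power of `f g`, which cancels in the first component because `A` is a domain.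
  obtain ⟨K, hK⟩ := hinj (r * r' - TrivSqZeroExt.inl (f * g) ^ (N + N')) (by
    simp only [map_sub, map_mul, map_pow, ← hr, ← hr']
    have := w.mul_inv
    linear_combination (j (i (TrivSqZeroExt.inl (f * g))) ^ (N + N')) * this)
  obtain ⟨M, hM⟩ : ∃ M, M = N + N' := ⟨_, rfl⟩
  have hfg : r.fst * r'.fst = f ^ M * g ^ M := by
    have h := congrArg TrivSqZeroExt.fst hK
    rw [TrivSqZeroExt.fst_mul, TrivSqZeroExt.fst_pow, TrivSqZeroExt.fst_inl,
      TrivSqZeroExt.fst_zero, mul_eq_zero_iff_left (pow_ne_zero _ (mul_ne_zero hf hg)),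
      TrivSqZeroExt.fst_sub, TrivSqZeroExt.fst_mul, TrivSqZeroExt.fst_pow, TrivSqZeroExt.fst_inl,
      sub_eq_zero, mul_pow] at h
    rw [h, hM]
  -- Reduced part: a divisor of `f^M g^M` is a divisor of `f^M` times a divisor of `g^M`, and these
  -- become units over `D(f)` and `D(g)`.
  obtain ⟨a, b, ha, hb, hab⟩ := exists_dvd_and_dvd_of_dvd_mul (Dvd.intro _ hfg)
  -- Nilpotent part: `r = r.fst (1 + (r.snd / r.fst) ε)`, and `1 / r.fst = r'.fst / (f g)^M`. The
  -- coefficient of `ε` is thus to be written as `P / f^{2M} + R / g^{2M}`, an additive splitting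
  -- which `1 + (·) ε` makes multiplicative.
  obtain ⟨P, R, hPR⟩ := exists_split_numerator g hf M (r.snd * r'.fst)
  have ua : IsUnit (i (TrivSqZeroExt.inl a)) := by
    obtain ⟨c, hc⟩ := ha
    have : IsUnit (i (TrivSqZeroExt.inl a) * i (TrivSqZeroExt.inl c)) := by
      rw [← map_mul, TrivSqZeroExt.inl_mul_inl, ← hc, ← TrivSqZeroExt.inl_pow, map_pow]
      exact hi.pow M
    exact isUnit_of_mul_isUnit_left this
  have ub : IsUnit (i' (TrivSqZeroExt.inl b)) := by
    obtain ⟨c, hc⟩ := hb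
    have : IsUnit (i' (TrivSqZeroExt.inl b) * i' (TrivSqZeroExt.inl c)) := by
      rw [← map_mul, TrivSqZeroExt.inl_mul_inl, ← hc, ← TrivSqZeroExt.inl_pow, map_pow]
      exact hi'.pow M
    exact isUnit_of_mul_isUnit_left this
  obtain ⟨F, hF⟩ := hi
  obtain ⟨G, hG⟩ := hi'
  obtain ⟨α, hα⟩ := ua
  obtain ⟨β, hβ⟩ := ub
  obtain ⟨α', hα'⟩ := isUnit_one_add_map_inr_mul i P (((F ^ M)⁻¹ : Sˣ) ^ 2 : Sˣ)
  obtain ⟨β', hβ'⟩ := isUnit_one_add_map_inr_mul i' R (((G ^ M)⁻¹ : S'ˣ) ^ 2 : S'ˣ)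
  refine ⟨α * α' * (F ^ N)⁻¹, β * β' * (G ^ N)⁻¹, ?_⟩
  set x : Qˣ := Units.map (j : S →* Q) F with hx
  set y : Qˣ := Units.map (j' : S' →* Q) G with hy
  have hxf : (x : Q) = j (i (TrivSqZeroExt.inl f)) := by rw [hx, Units.coe_map, hF]; rfl
  have hyg : (y : Q) = j (i (TrivSqZeroExt.inl g)) := by rw [hy, Units.coe_map, hG, hj]; rfl
  have e1 : j ((F ^ N)⁻¹ : Sˣ) = ((x ^ N)⁻¹ : Qˣ) := by
    rw [hx, ← map_pow, ← map_inv]; rfl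
  have e2 : j' ((G ^ N)⁻¹ : S'ˣ) = ((y ^ N)⁻¹ : Qˣ) := by
    rw [hy, ← map_pow, ← map_inv]; rfl
  have e3 : j (((F ^ M)⁻¹ : Sˣ) ^ 2 : Sˣ) = (((x ^ M)⁻¹) ^ 2 : Qˣ) := by
    rw [hx, ← map_pow, ← map_inv, ← map_pow]; rfl
  have e4 : j' (((G ^ M)⁻¹ : S'ˣ) ^ 2 : S'ˣ) = (((y ^ M)⁻¹) ^ 2 : Qˣ) := by
    rw [hy, ← map_pow, ← map_inv, ← map_pow]; rfl
  simp only [Units.val_mul, map_mul, hα, hβ, hα', hβ', map_add, map_one, e1, e2, e3, e4, ← hj]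
  have hr2 : (w : Q) * ((x : Q) * y) ^ N = j (i r) := by
    rw [hxf, hyg, ← map_mul, ← map_mul, TrivSqZeroExt.inl_mul_inl, hr]
  have key : (j (i (TrivSqZeroExt.inl a)) * j (i (TrivSqZeroExt.inl b))) *
      ((1 + j (i (TrivSqZeroExt.inr P)) * (((x ^ M)⁻¹) ^ 2 : Qˣ)) *
        (1 + j (i (TrivSqZeroExt.inr R)) * (((y ^ M)⁻¹) ^ 2 : Qˣ))) = j (i r) := by
    have h0 : j (i (TrivSqZeroExt.inr P)) * j (i (TrivSqZeroExt.inr R)) = 0 := by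
      rw [← map_mul, ← map_mul, TrivSqZeroExt.inr_mul_inr, map_zero, map_zero]
    have hPR' : j (i (TrivSqZeroExt.inr (r.snd * r'.fst))) * (x ^ M * y ^ M) =
        j (i (TrivSqZeroExt.inr P)) * (y ^ M) ^ 2 + j (i (TrivSqZeroExt.inr R)) * (x ^ M) ^ 2 := by
      rw [hxf, hyg]
      simp only [← map_mul, ← map_add, ← map_pow, TrivSqZeroExt.inl_pow]
      simp only [← TrivSqZeroExt.inl_mul, TrivSqZeroExt.inr_mul_inl, MulOpposite.smul_eq_mul_unop,
        MulOpposite.unop_op, ← TrivSqZeroExt.inr_add]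
      rw [← hPR, mul_pow]
    have hr0 : j (i (TrivSqZeroExt.inl a)) * j (i (TrivSqZeroExt.inl b)) =
        j (i (TrivSqZeroExt.inl r.fst)) := by
      rw [← map_mul, ← map_mul, TrivSqZeroExt.inl_mul_inl, hab]
    have hr1 : j (i r) = j (i (TrivSqZeroExt.inl r.fst)) + j (i (TrivSqZeroExt.inr r.snd)) := by
      rw [← map_add, ← map_add, TrivSqZeroExt.inl_fst_add_inr_snd_eq]
    have hr3 : j (i (TrivSqZeroExt.inl r.fst)) * j (i (TrivSqZeroExt.inr (r.snd * r'.fst))) =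
        x ^ M * y ^ M * j (i (TrivSqZeroExt.inr r.snd)) := by
      rw [hxf, hyg]
      simp only [← map_mul, ← map_pow, TrivSqZeroExt.inl_pow, ← TrivSqZeroExt.inl_mul,
        TrivSqZeroExt.inl_mul_inr, smul_eq_mul]
      rw [← hfg]
      congr 3
      ring
    rw [hr0, hr1]
    set Z : Qˣ := x ^ M
    set Y : Qˣ := y ^ M
    have hZ : (Z : Q) = x ^ M := by simp [Z]
    have hY : (Y : Q) = y ^ M := by simp [Y]
    rw [← hZ, ← hY] at hPR' hr3
    have cZ := Z.mul_inv
    have cY := Y.mul_inv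
    -- Multiplication by the unit `f^{2M} g^{2M}` clears all inverses.
    refine (Z * Y * (Z * Y)).isUnit.mul_left_injective ?_
    simp only [Units.val_mul, Units.val_pow_eq_pow_val]
    generalize ((Z⁻¹ : Qˣ) : Q) = Z' at *
    generalize ((Y⁻¹ : Qˣ) : Q) = Y' at *
    generalize (Z : Q) = Z at *
    generalize (Y : Q) = Y at *
    generalize j (i (TrivSqZeroExt.inl r.fst)) = r0 at *
    generalize j (i (TrivSqZeroExt.inr r.snd)) = r1 at *
    generalize j (i (TrivSqZeroExt.inr P)) = p at *
    generalize j (i (TrivSqZeroExt.inr R)) = q at *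
    generalize j (i (TrivSqZeroExt.inr (r.snd * r'.fst))) = s at *
    have h1 : Z' ^ 2 * Z ^ 2 = 1 := by rw [← mul_pow, mul_comm, cZ, one_pow]
    have h2 : Y' ^ 2 * Y ^ 2 = 1 := by rw [← mul_pow, mul_comm, cY, one_pow]
    have h3 : (1 + p * Z' ^ 2) * (1 + q * Y' ^ 2) = 1 + p * Z' ^ 2 + q * Y' ^ 2 := by
      linear_combination (Z' ^ 2 * Y' ^ 2) * h0
    rw [h3]
    linear_combination (r0 * p * Y ^ 2) * h1 + (r0 * q * Z ^ 2) * h2 - r0 * hPR' + Z * Y * hr3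
  have cx := (x ^ N).mul_inv
  have cy := (y ^ N).mul_inv
  simp only [Units.val_pow_eq_pow_val] at cx cy
  rw [← hr2] at key
  generalize (((x ^ N)⁻¹ : Qˣ) : Q) = x' at *
  generalize (((y ^ N)⁻¹ : Qˣ) : Q) = y' at *
  linear_combination (x' * y') * key + w * cx + w * x ^ N * x' * cy

end Trivial

/-! ### Freeness over an affine chart, by gluing frames on basic open sets. -/

section TrivialOnAffine

variable {C : Scheme.{u}} {A : Type u} [EuclideanDomain A] {U : C.Opens}

/-- The basic open subset of `Spec A[ε]/ε²` defined by an element of `A`. -/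
def baseOpen (φ : Γ(C, U) ≃+* DualNumber A) (f : A) : C.Opens :=
  C.basicOpen (φ.symm (TrivSqZeroExt.inl f))

/-- The `ε`-part is nilpotent, so its basic open set is empty and does not affect the sum. Hence
only the reduction in `A` matters, and the freeness locus can be recorded by an ideal of `A`. -/
lemma basicOpen_eq_baseOpen (φ : Γ(C, U) ≃+* DualNumber A) (r : Γ(C, U)) :
    C.basicOpen r = baseOpen φ (φ r).fst := by
  have h1 : r = φ.symm (TrivSqZeroExt.inl (φ r).fst) + φ.symm (TrivSqZeroExt.inr (φ r).snd) := by
    rw [← map_add, TrivSqZeroExt.inl_fst_add_inr_snd_eq, RingEquiv.symm_apply_apply]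
  have h2 : IsNilpotent (φ.symm (TrivSqZeroExt.inr (φ r).snd)) :=
    ⟨2, by rw [pow_two, ← map_mul, TrivSqZeroExt.inr_mul_inr, map_zero]⟩
  have h3 : C.basicOpen (φ.symm (TrivSqZeroExt.inr (φ r).snd)) = ⊥ :=
    C.basicOpen_eq_bot_of_isNilpotent _ _ h2
  refine le_antisymm ?_ ?_
  · conv_lhs => rw [h1]
    refine (C.basicOpen_add_le _ _).trans ?_
    rw [h3, sup_bot_eq]
    rfl
  · have h4 : φ.symm (TrivSqZeroExt.inl (φ r).fst) =
        r + φ.symm (TrivSqZeroExt.inr (-(φ r).snd)) := by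
      rw [TrivSqZeroExt.inr_neg, map_neg, ← sub_eq_add_neg, eq_sub_iff_add_eq]
      exact h1.symm
    have h5 : C.basicOpen (φ.symm (TrivSqZeroExt.inr (-(φ r).snd))) = ⊥ :=
      C.basicOpen_eq_bot_of_isNilpotent _ _
        ⟨2, by rw [pow_two, ← map_mul, TrivSqZeroExt.inr_mul_inr, map_zero]⟩
    rw [baseOpen, h4]
    refine (C.basicOpen_add_le _ _).trans ?_
    rw [h5, sup_bot_eq]

lemma baseOpen_le (φ : Γ(C, U) ≃+* DualNumber A) (f : A) : baseOpen φ f ≤ U :=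
  C.basicOpen_le _

lemma baseOpen_mul (φ : Γ(C, U) ≃+* DualNumber A) (f g : A) :
    baseOpen φ (f * g) = baseOpen φ f ⊓ baseOpen φ g := by
  rw [baseOpen, TrivSqZeroExt.inl_mul, map_mul, C.basicOpen_mul]
  rfl

lemma baseOpen_add_le (φ : Γ(C, U) ≃+* DualNumber A) (f g : A) :
    baseOpen φ (f + g) ≤ baseOpen φ f ⊔ baseOpen φ g := by
  rw [baseOpen, TrivSqZeroExt.inl_add, map_add]
  exact C.basicOpen_add_le _ _

lemma baseOpen_one (φ : Γ(C, U) ≃+* DualNumber A) : baseOpen φ 1 = U := by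
  rw [baseOpen, TrivSqZeroExt.inl_one, map_one]
  exact C.basicOpen_of_isUnit isUnit_one

lemma isUnit_fres_baseOpen (φ : Γ(C, U) ≃+* DualNumber A) (f : A) :
    IsUnit (fres (baseOpen_le φ f) (φ.symm (TrivSqZeroExt.inl f))) :=
  RingedSpace.isUnit_res_basicOpen _ _

/-- Units on the intersection of two basic open subsets split. -/
lemma exists_split_unit_baseOpen (hU : IsAffineOpen U) (φ : Γ(C, U) ≃+* DualNumber A) {f g : A}
    (hf : f ≠ 0) (hg : g ≠ 0) (w : Γ(C, baseOpen φ f ⊓ baseOpen φ g)ˣ) :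
    ∃ (a : Γ(C, baseOpen φ f)ˣ) (b : Γ(C, baseOpen φ g)ˣ),
      fres (inf_le_left : baseOpen φ f ⊓ baseOpen φ g ≤ _) (a : Γ(C, baseOpen φ f)) *
        fres (inf_le_right : baseOpen φ f ⊓ baseOpen φ g ≤ _) (b : Γ(C, baseOpen φ g)) = w := by
  have hle : baseOpen φ f ⊓ baseOpen φ g ≤ U := inf_le_left.trans (baseOpen_le φ f)
  let := (fres hle).toAlgebra
  have hloc : IsLocalization.Away (φ.symm (TrivSqZeroExt.inl (f * g)))
      Γ(C, baseOpen φ f ⊓ baseOpen φ g) :=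
    hU.isLocalization_of_eq_basicOpen _ (homOfLE hle) (baseOpen_mul φ f g).symm
  refine exists_split_unit hf hg ((fres (baseOpen_le φ f)).comp φ.symm.toRingHom)
    ((fres (baseOpen_le φ g)).comp φ.symm.toRingHom) (fres inf_le_left) (fres inf_le_right)
    (fun r => ?_) (isUnit_fres_baseOpen φ f) (isUnit_fres_baseOpen φ g) (fun q => ?_)
    (fun r hr => ?_) w
  · change fres _ (fres _ _) = fres _ (fres _ _)
    rw [fres_fres, fres_fres]
  · obtain ⟨N, r, hr⟩ := IsLocalization.Away.surj (φ.symm (TrivSqZeroExt.inl (f * g))) q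
    refine ⟨N, φ r, ?_⟩
    change q * fres _ (fres _ (φ.symm _)) ^ N = fres _ (fres _ (φ.symm (φ r)))
    rw [RingEquiv.symm_apply_apply, fres_fres, fres_fres]
    exact hr
  · have hr' : fres hle (φ.symm r) = fres hle 0 := by
      rw [map_zero, ← hr]
      exact (fres_fres _ _ _).symm
    obtain ⟨⟨_, N, rfl⟩, hN⟩ := IsLocalization.exists_of_eq
      (M := Submonoid.powers (φ.symm (TrivSqZeroExt.inl (f * g)))) (x := φ.symm r) (y := 0) hr'
    refine ⟨N, φ.symm.injective ?_⟩
    simpa only [map_mul, map_pow, map_zero, mul_zero] using hN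

variable {L : C.Modules}

/-- The elements `f` of `A` such that `L` is free of rank one on the basic open set of `f`
form an ideal. -/
def trivializingIdeal (hU : IsAffineOpen U) (φ : Γ(C, U) ≃+* DualNumber A) (L : C.Modules) :
    Ideal A where
  -- Zero is admitted separately because the splitting of units requires nonzero `f` and `g`.
  carrier := {f | f = 0 ∨ ∃ e : Γ(L, baseOpen φ f), IsFrame L _ e}
  zero_mem' := Or.inl rfl
  smul_mem' := by
    rintro a f (rfl | ⟨e, he⟩)
    · exact Or.inl (smul_zero a)
    · have h : baseOpen φ (a • f) ≤ baseOpen φ f := by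
        rw [smul_eq_mul, baseOpen_mul]; exact inf_le_right
      exact Or.inr ⟨_, he.of_le h⟩
  add_mem' := by
    intro f g hf hg
    by_cases hf0 : f = 0
    · rwa [hf0, zero_add]
    by_cases hg0 : g = 0
    · rwa [hg0, add_zero]
    obtain ⟨e, he⟩ := hf.resolve_left hf0
    obtain ⟨e', he'⟩ := hg.resolve_left hg0
    -- The transition unit on `D(f) ∩ D(g)` splits, so the frames glue over `D(f) ∪ D(g)`, which
    -- contains `D(f + g)`.
    obtain ⟨s, hs⟩ := he.exists_of_split he' (exists_split_unit_baseOpen hU φ hf0 hg0)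
    exact Or.inr ⟨_, hs.of_le (baseOpen_add_le φ f g)⟩

/-- A line bundle is free on an affine open subset with coordinate ring `A[ε]/ε²`, for `A` a
Euclidean domain. -/
lemma exists_frame_of_affine (hU : IsAffineOpen U) (φ : Γ(C, U) ≃+* DualNumber A)
    (hL : IsLineBundle L) : ∃ e : Γ(L, U), IsFrame L U e := by
  set J := trivializingIdeal hU φ L
  have hcov : U ≤ ⨆ r : {r : Γ(C, U) | (φ r).fst ∈ J}, C.basicOpen (r : Γ(C, U)) := by
    intro x hx
    obtain ⟨V, hxV, e, he⟩ := hL x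
    obtain ⟨r, hr, hxr⟩ := hU.exists_basicOpen_le ⟨x, hxV⟩ hx
    refine Opens.mem_iSup.mpr ⟨⟨r, Or.inr ?_⟩, hxr⟩
    rw [basicOpen_eq_baseOpen φ] at hr
    exact ⟨_, he.of_le hr⟩
  -- Local freeness gives a cover by basic open sets whose functions reduce into `J`. These
  -- functions generate the unit ideal, so `1 ∈ J`, which is freeness on all of `U`.
  have htop := hU.self_le_iSup_basicOpen_iff.mp hcov
  have hJ : J.comap ((TrivSqZeroExt.fstHom A A A : DualNumber A →+* A).comp φ.toRingHom) = ⊤ := by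
    rw [eq_top_iff, ← htop, Ideal.span_le]
    exact fun r hr => hr
  have h1 : (1 : A) ∈ J := by
    have := hJ ▸ (Submodule.mem_top : (1 : Γ(C, U)) ∈ (⊤ : Ideal Γ(C, U)))
    rwa [Ideal.mem_comap, map_one] at this
  obtain ⟨e, he⟩ := h1.resolve_left one_ne_zero
  exact ⟨_, he.of_le (baseOpen_one φ).ge⟩

end TrivialOnAffine

/-! ## Kernel and cokernel of a block triangular map -/

section BlockTriangular

variable {k V V' V'' W W' W'' K' K'' E' E'' : Type*} [Field k]
  [AddCommGroup V] [AddCommGroup V'] [AddCommGroup V''] [AddCommGroup W] [AddCommGroup W']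
  [AddCommGroup W''] [AddCommGroup K'] [AddCommGroup K''] [AddCommGroup E'] [AddCommGroup E'']
  [Module k V] [Module k V'] [Module k V''] [Module k W] [Module k W'] [Module k W'']
  [Module k K'] [Module k K''] [Module k E'] [Module k E'']

/-- Every linear map between vector spaces has a pseudo-inverse. -/
lemma exists_pseudoInverse (p : V →ₗ[k] W) :
    ∃ s : W →ₗ[k] V, ∀ w ∈ LinearMap.range p, p (s w) = w := by
  obtain ⟨s, hs⟩ := p.rangeRestrict.exists_rightInverse_of_surjective p.range_rangeRestrict
  obtain ⟨s', hs'⟩ := LinearMap.exists_extend s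
  refine ⟨s', fun w hw => ?_⟩
  have h1 := LinearMap.congr_fun hs' ⟨w, hw⟩
  have h2 := LinearMap.congr_fun hs ⟨w, hw⟩
  have h3 : s' w = s ⟨w, hw⟩ := h1
  rw [h3]
  exact congrArg Subtype.val h2

variable (p : V' →ₗ[k] W') (q : V'' →ₗ[k] W'') (θ : V'' →ₗ[k] W') (Ψ : V →ₗ[k] W)
  (a : V ≃ₗ[k] V'' × V') (b : W ≃ₗ[k] W'' × W')
  (hΨ : ∀ v, b (Ψ v) = (q (a v).1, p (a v).2 + θ (a v).1))
  (ι : K' →ₗ[k] V') (hι : Function.Injective ι) (hιp : LinearMap.range ι = LinearMap.ker p)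
  (κ : K'' →ₗ[k] V'') (hκ : Function.Injective κ) (hκq : LinearMap.range κ = LinearMap.ker q)
  (c' : W' →ₗ[k] E') (hc' : Function.Surjective c') (hc'p : LinearMap.ker c' = LinearMap.range p)
  (c'' : W'' →ₗ[k] E'') (hc'' : Function.Surjective c'')
  (hc''q : LinearMap.ker c'' = LinearMap.range q)

-- This and the next lemma are the snake sequence `0 → ker p → ker Ψ → ker q → coker p → coker Ψ →
-- coker q → 0`, with `K' = ker p`, `K'' = ker q`, `E' = coker p`, `E'' = coker q` and connecting
-- map `c' ∘ θ ∘ κ`.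
include hΨ hι hιp hκ hκq hc'p in
lemma finrank_ker_blockTriangular [Module.Finite k K'] [Module.Finite k K''] :
    Module.finrank k (LinearMap.ker Ψ) =
      Module.finrank k K' + Module.finrank k (LinearMap.ker (c' ∘ₗ θ ∘ₗ κ)) := by
  obtain ⟨s, hs⟩ := exists_pseudoInverse p
  -- A class `y` with zero connecting image lifts to `(κ y, -s (θ (κ y)))`: the correction by `s`
  -- solves `p v' + θ (κ y) = 0`.
  let f : K' × LinearMap.ker (c' ∘ₗ θ ∘ₗ κ) →ₗ[k] V :=
    a.symm.toLinearMap ∘ₗ LinearMap.prod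
      (κ ∘ₗ Submodule.subtype _ ∘ₗ LinearMap.snd k _ _)
      (ι ∘ₗ LinearMap.fst k _ _ - s ∘ₗ θ ∘ₗ κ ∘ₗ Submodule.subtype _ ∘ₗ LinearMap.snd k _ _)
  have haf : ∀ x, a (f x) = (κ x.2, ι x.1 - s (θ (κ x.2))) := by
    intro x; simp [f]
  have hf : Function.Injective f := by
    rw [injective_iff_map_eq_zero]
    intro x hx
    have h := haf x
    rw [hx, map_zero, eq_comm, Prod.mk_eq_zero] at h
    have h2 : (x.2 : K'') = 0 := hκ (h.1.trans (map_zero κ).symm)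
    rw [h2] at h
    simp only [map_zero, sub_zero] at h
    exact Prod.ext (hι (h.2.trans (map_zero ι).symm)) (Subtype.ext h2)
  have hr : LinearMap.range f = LinearMap.ker Ψ := by
    ext v
    rw [LinearMap.mem_range, LinearMap.mem_ker, ← b.map_eq_zero_iff, hΨ, Prod.mk_eq_zero]
    constructor
    · rintro ⟨x, rfl⟩
      rw [haf]
      have h1 : κ x.2 ∈ LinearMap.ker q := hκq ▸ LinearMap.mem_range_self κ _
      have h2 : ι x.1 ∈ LinearMap.ker p := hιp ▸ LinearMap.mem_range_self ι _
      have h3 : θ (κ x.2) ∈ LinearMap.range p := hc'p ▸ x.2.2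
      rw [LinearMap.mem_ker] at h1 h2
      simp [h1, h2, hs _ h3]
    · rintro ⟨h1, h2⟩
      obtain ⟨y, hy⟩ : (a v).1 ∈ LinearMap.range κ := hκq ▸ h1
      have h3 : θ (κ y) ∈ LinearMap.range p :=
        ⟨-(a v).2, by rw [map_neg, hy]; exact neg_eq_of_add_eq_zero_right h2⟩
      obtain ⟨x, hx⟩ : (a v).2 + s (θ (κ y)) ∈ LinearMap.range ι := by
        rw [hιp, LinearMap.mem_ker, map_add, hs _ h3, hy, h2]
      refine ⟨(x, ⟨y, hc'p.ge h3⟩), a.injective ?_⟩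
      rw [haf]
      exact Prod.ext hy (by simp [hx])
  rw [← hr, LinearMap.finrank_range_of_inj hf, Module.finrank_prod]

include hΨ hκq hc' hc'p hc'' hc''q in
lemma finrank_coker_blockTriangular [Module.Finite k E'] [Module.Finite k E''] :
    Module.finrank k (W ⧸ LinearMap.range Ψ) =
      Module.finrank k E'' + Module.finrank k (E' ⧸ LinearMap.range (c' ∘ₗ θ ∘ₗ κ)) := by
  obtain ⟨s, hs⟩ := exists_pseudoInverse q
  -- Lifting the first component along `q` by `s` and subtracting its `θ`-image leaves an element of
  -- `W'`. The lift is unique only up to `ker q`, whence the quotient by the image of the connecting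
  -- map.
  let f : W →ₗ[k] E'' × (E' ⧸ LinearMap.range (c' ∘ₗ θ ∘ₗ κ)) :=
    LinearMap.prod (c'' ∘ₗ LinearMap.fst k _ _)
      (Submodule.mkQ _ ∘ₗ c' ∘ₗ (LinearMap.snd k _ _ - θ ∘ₗ s ∘ₗ LinearMap.fst k _ _)) ∘ₗ
      b.toLinearMap
  have hf : ∀ w, f w = (c'' (b w).1, Submodule.Quotient.mk (c' ((b w).2 - θ (s (b w).1)))) :=
    fun w => rfl
  have hsurj : Function.Surjective f := by
    rintro ⟨x, y⟩
    obtain ⟨y, rfl⟩ := Submodule.Quotient.mk_surjective _ y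
    obtain ⟨w'', rfl⟩ := hc'' x
    obtain ⟨w', rfl⟩ := hc' y
    refine ⟨b.symm (w'', w' + θ (s w'')), ?_⟩
    rw [hf]
    simp
  have hk : LinearMap.ker f = LinearMap.range Ψ := by
    ext w
    rw [LinearMap.mem_ker, hf, Prod.mk_eq_zero, Submodule.Quotient.mk_eq_zero]
    constructor
    · rintro ⟨h1, y, hy⟩
      obtain h1 : (b w).1 ∈ LinearMap.range q := hc''q ▸ h1
      have h2 : (b w).2 - θ (s (b w).1) - θ (κ y) ∈ LinearMap.range p := by
        rw [← hc'p, LinearMap.mem_ker, map_sub, ← hy]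
        exact sub_self _
      obtain ⟨v', hv'⟩ := h2
      have h3 : q (κ y) = 0 := by
        have : κ y ∈ LinearMap.ker q := hκq ▸ LinearMap.mem_range_self κ y
        exact this
      refine ⟨a.symm (s (b w).1 + κ y, v'), b.injective ?_⟩
      rw [hΨ, LinearEquiv.apply_symm_apply]
      refine Prod.ext ?_ ?_
      · simp [h3, hs _ h1]
      · simp only [hv', map_add]
        abel
    · rintro ⟨v, rfl⟩
      have h1 : q (a v).1 ∈ LinearMap.range q := LinearMap.mem_range_self _ _
      obtain ⟨y, hy⟩ : (a v).1 - s (q (a v).1) ∈ LinearMap.range κ := by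
        rw [hκq, LinearMap.mem_ker, map_sub, hs _ h1, sub_self]
      rw [hΨ]
      refine ⟨hc''q.ge h1, y, ?_⟩
      have h2 : c' (p (a v).2) = 0 := hc'p.ge (LinearMap.mem_range_self p _)
      simp only [LinearMap.comp_apply, hy, map_sub, map_add, h2]
      abel
  rw [← hk, (f.quotKerEquivOfSurjective hsurj).finrank_eq, Module.finrank_prod]

end BlockTriangular

/-! ## The Čech complex of `𝒪(d)` on the projective line -/

section LaurentTails

open Polynomial (toLaurent)
open LaurentPolynomial (T invert)

variable {k : Type u} [Field k]

lemma coeff_toLaurent' (p : k[X]) (j : ℤ) :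
    (toLaurent p).coeff j = if 0 ≤ j then p.coeff j.toNat else 0 := by
  induction p using Polynomial.induction_on' with
  | add p q hp hq =>
    simp only [map_add, AddMonoidAlgebra.coeff_add, Finsupp.add_apply, hp, hq,
      Polynomial.coeff_add]
    split_ifs <;> simp
  | monomial n a =>
    rw [Polynomial.toLaurent_C_mul_T, ← LaurentPolynomial.single_eq_C_mul_T,
      Polynomial.coeff_monomial, AddMonoidAlgebra.coeff_single, Finsupp.single_apply]
    split_ifs <;> first | rfl | omega

lemma coeff_mul_T (f : k[T;T⁻¹]) (d j : ℤ) : (f * T d).coeff j = f.coeff (j - d) := by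
  induction f using LaurentPolynomial.induction_on' with
  | add p q hp hq => simp only [add_mul, AddMonoidAlgebra.coeff_add, Finsupp.add_apply, hp, hq]
  | C_mul_T n a =>
    rw [LaurentPolynomial.mul_T_assoc, ← LaurentPolynomial.single_eq_C_mul_T,
      ← LaurentPolynomial.single_eq_C_mul_T, AddMonoidAlgebra.coeff_single,
      AddMonoidAlgebra.coeff_single, Finsupp.single_apply, Finsupp.single_apply]
    split_ifs <;> first | rfl | omega

/-- The Čech differential of `𝒪(d)` on the projective line: `(a, b) ↦ a(t⁻¹) t^d - b(t)`. -/
def lineCech (d : ℤ) : k[X] × k[X] →ₗ[k] k[T;T⁻¹] :=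
  (LinearMap.mulRight k (T d) ∘ₗ invert.toLinearMap ∘ₗ Polynomial.toLaurentAlg.toLinearMap) ∘ₗ
      LinearMap.fst k _ _ -
    Polynomial.toLaurentAlg.toLinearMap ∘ₗ LinearMap.snd k _ _

lemma lineCech_apply (d : ℤ) (x : k[X] × k[X]) :
    lineCech d x = invert (toLaurent x.1) * T d - toLaurent x.2 := rfl

lemma coeff_lineCech (d : ℤ) (x : k[X] × k[X]) (j : ℤ) : (lineCech d x).coeff j =
    (if j ≤ d then x.1.coeff (d - j).toNat else 0) - if 0 ≤ j then x.2.coeff j.toNat else 0 := by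
  rw [lineCech_apply, AddMonoidAlgebra.coeff_sub, Finsupp.sub_apply, coeff_mul_T,
    LaurentPolynomial.invert_apply, coeff_toLaurent', coeff_toLaurent']
  simp only [neg_sub, sub_nonneg]

/-- The coefficients of `t⁻¹, …, t^{-N}`. -/
def tailCoeff (N : ℕ) : k[T;T⁻¹] →ₗ[k] (Fin N → k) where
  toFun f i := f.coeff (-((i : ℤ) + 1))
  map_add' f g := by ext; simp
  map_smul' c f := by ext; simp

lemma tailCoeff_apply (N : ℕ) (f : k[T;T⁻¹]) (i : Fin N) :
    tailCoeff N f i = f.coeff (-((i : ℤ) + 1)) := rfl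

lemma coeff_tail {N : ℕ} (a : Fin N → k) (j : ℤ) : (tail a).coeff j = entry a (-j).toNat := by
  rw [tail, AddMonoidAlgebra.coeff_sum, Finsupp.finsetSum_apply]
  simp only [← LaurentPolynomial.single_eq_C_mul_T, AddMonoidAlgebra.coeff_single,
    Finsupp.single_apply]
  rw [entry]
  split_ifs with h
  · rw [Finset.sum_eq_single ⟨(-j).toNat - 1, by omega⟩]
    · rw [if_pos (by simp; omega)]
    · intro b _ hb
      rw [if_neg]
      intro h'
      exact hb (Fin.ext (by simp; omega))
    · simp
  · refine Finset.sum_eq_zero fun b _ => if_neg ?_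
    have := b.2
    omega

lemma tailCoeff_tail {N : ℕ} (a : Fin N → k) : tailCoeff N (tail a) = a := by
  ext i
  rw [tailCoeff_apply, coeff_tail, entry, dif_pos (by have := i.2; omega)]
  exact congrArg a (Fin.ext (by simp))

lemma tailCoeff_surjective (N : ℕ) : Function.Surjective (tailCoeff (k := k) N) :=
  fun a => ⟨tail a, tailCoeff_tail a⟩

/-- The monomial `t^j` comes from the chart at infinity when `j ≤ d` and from the other chart when
`0 ≤ j`. The obstructions are the coefficients with `d < j < 0`, so `tailCoeff` identifies
`H¹(𝒪(d))` with `k^N`; truncation gives `N = 0` for `d ≥ -1`. -/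
lemma ker_tailCoeff {N : ℕ} {d : ℤ} (hN : N = (-d - 1).toNat) :
    LinearMap.ker (tailCoeff (k := k) N) = LinearMap.range (lineCech d) := by
  subst hN
  apply le_antisymm
  · intro f hf
    have hf' : ∀ j, d < j → j < 0 → f.coeff j = 0 := by
      intro j h1 h2
      have := congrFun hf ⟨(-j - 1).toNat, by omega⟩
      rw [tailCoeff_apply, Pi.zero_apply] at this
      rwa [show -((((-j - 1).toNat : ℕ) : ℤ) + 1) = j by omega] at this
    have hsum : f = ∑ j ∈ f.coeff.support, f.coeff j • T j := by
      ext j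
      rw [AddMonoidAlgebra.coeff_sum, Finsupp.finsetSum_apply]
      simp
    rw [hsum]
    refine Submodule.sum_mem _ fun j hj => Submodule.smul_mem _ _ ?_
    rw [Finsupp.mem_support_iff] at hj
    rcases le_or_gt j d with h | h
    · refine ⟨(Polynomial.X ^ (d - j).toNat, 0), ?_⟩
      rw [lineCech_apply, Polynomial.toLaurent_X_pow, LaurentPolynomial.invert_T,
        ← LaurentPolynomial.T_add, map_zero, sub_zero]
      congr 1; omega
    · have h0 : 0 ≤ j := by
        by_contra h0
        exact hj (hf' j h (by omega))
      refine ⟨(0, -Polynomial.X ^ j.toNat), ?_⟩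
      rw [lineCech_apply, map_neg, Polynomial.toLaurent_X_pow, map_zero, map_zero, zero_mul,
        zero_sub, neg_neg]
      congr 1; omega
  · rintro _ ⟨x, rfl⟩
    ext i
    have := i.2
    rw [tailCoeff_apply, coeff_lineCech, if_neg (by omega), if_neg (by omega), sub_zero]
    rfl

/-- The sections of `𝒪(d)`: the vector `v` corresponds to `∑ v_l t^l`. -/
def lineKer (N : ℕ) (d : ℤ) : (Fin N → k) →ₗ[k] k[X] × k[X] :=
  LinearMap.prod
    (∑ l : Fin N, (Polynomial.monomial (d - l).toNat) ∘ₗ LinearMap.proj l)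
    (∑ l : Fin N, (Polynomial.monomial (l : ℕ)) ∘ₗ LinearMap.proj l)

lemma lineKer_apply (N : ℕ) (d : ℤ) (v : Fin N → k) :
    lineKer N d v = (∑ l : Fin N, Polynomial.monomial (d - l).toNat (v l),
      ∑ l : Fin N, Polynomial.monomial (l : ℕ) (v l)) := by
  simp [lineKer]

lemma coeff_lineKer_snd (N : ℕ) (d : ℤ) (v : Fin N → k) (j : ℕ) :
    (lineKer N d v).2.coeff j = if h : j < N then v ⟨j, h⟩ else 0 := by
  rw [lineKer_apply]
  simp only [Polynomial.finsetSum_coeff, Polynomial.coeff_monomial]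
  split_ifs with h
  · rw [Finset.sum_eq_single ⟨j, h⟩]
    · simp
    · intro b _ hb
      exact if_neg fun h' => hb (Fin.ext h')
    · simp
  · exact Finset.sum_eq_zero fun b _ => if_neg (by have := b.2; omega)

lemma coeff_lineKer_fst {N : ℕ} {d : ℤ} (hN : N = (d + 1).toNat) (v : Fin N → k) (j : ℕ) :
    (lineKer N d v).1.coeff j =
      if h : (j : ℤ) ≤ d then v ⟨(d - j).toNat, by omega⟩ else 0 := by
  rw [lineKer_apply]
  simp only [Polynomial.finsetSum_coeff, Polynomial.coeff_monomial]
  split_ifs with h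
  · rw [Finset.sum_eq_single ⟨(d - j).toNat, by omega⟩]
    · rw [if_pos (by simp; omega)]
    · intro b _ hb
      refine if_neg fun h' => hb (Fin.ext ?_)
      have := b.2
      simp; omega
    · simp
  · exact Finset.sum_eq_zero fun b _ => if_neg (by have := b.2; omega)

lemma lineKer_injective (N : ℕ) (d : ℤ) : Function.Injective (lineKer (k := k) N d) := by
  intro v v' h
  ext l
  have := congrArg (fun x => x.2.coeff (l : ℕ)) h
  simpa only [coeff_lineKer_snd, dif_pos l.2] using this

/-- The equation `a(t⁻¹) t^d = b(t)` says that `b` has degree at most `d` and that `a` is `b` with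
its coefficients reversed, so `lineKer` parametrizes `H⁰(𝒪(d))`. For `d < 0` both sides vanish and
`N = 0`. -/
lemma range_lineKer {N : ℕ} {d : ℤ} (hN : N = (d + 1).toNat) :
    LinearMap.range (lineKer (k := k) N d) = LinearMap.ker (lineCech d) := by
  apply le_antisymm
  · rintro _ ⟨v, rfl⟩
    rw [LinearMap.mem_ker]
    ext j
    rw [coeff_lineCech, coeff_lineKer_fst hN, coeff_lineKer_snd]
    simp only [AddMonoidAlgebra.coeff_zero, Finsupp.zero_apply]
    split_ifs <;> first | omega | skip
    all_goals first | simp; done | skip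
    rw [sub_eq_zero]
    congr 1
    exact Fin.ext (by simp; omega)
  · intro x hx
    have hc : ∀ j : ℤ, (if j ≤ d then x.1.coeff (d - j).toNat else 0) -
        (if 0 ≤ j then x.2.coeff j.toNat else 0) = 0 := by
      intro j
      rw [← coeff_lineCech, LinearMap.mem_ker.mp hx]
      rfl
    refine ⟨fun l => x.2.coeff l, Prod.ext ?_ ?_⟩
    · ext j
      rw [coeff_lineKer_fst hN]
      have := hc (d - j)
      rw [if_pos (by omega), sub_eq_zero] at this
      rw [show (d - (d - (j : ℤ))).toNat = j by omega] at this
      rw [this]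
      split_ifs <;> first | rfl | omega
    · ext j
      rw [coeff_lineKer_snd]
      have := hc j
      rw [if_pos (by omega : (0 : ℤ) ≤ j), sub_eq_zero, Int.toNat_natCast] at this
      split_ifs with h
      · rfl
      · rw [← this, if_neg (by omega)]

end LaurentTails

/-! ## Transition functions -/

section Transition

open Polynomial (toLaurent)
open LaurentPolynomial (T invert)

variable {k : Type u} [Field k]

/-- First-order Taylor expansion of `(t + Fη)^m`, valid for negative `m` because `t` is a unit. The
factor `m` is the origin of the multiples `(j-1) F` in `A_F(G)`. -/
lemma tUnit_zpow (F : k[T;T⁻¹]) (m : ℤ) :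
    ((tUnit F ^ m : (DualNumber k[T;T⁻¹])ˣ) : DualNumber k[T;T⁻¹]) =
      TrivSqZeroExt.inl (T m) + TrivSqZeroExt.inr ((m : k[T;T⁻¹]) * (T (m - 1) * F)) := by
  have hv : (tUnit F : DualNumber k[T;T⁻¹]) =
    TrivSqZeroExt.inl (T 1) + TrivSqZeroExt.inr F := rfl
  have step : ∀ m : ℤ, (TrivSqZeroExt.inl (T m) +
      TrivSqZeroExt.inr ((m : k[T;T⁻¹]) * (T (m - 1) * F)) : DualNumber k[T;T⁻¹]) *
      (tUnit F : DualNumber k[T;T⁻¹]) =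
      TrivSqZeroExt.inl (T (m + 1)) +
        TrivSqZeroExt.inr (((m + 1 : ℤ) : k[T;T⁻¹]) * (T (m + 1 - 1) * F)) := by
    intro m
    have h1 : (T (m + 1 - 1) : k[T;T⁻¹]) = T m := by rw [add_sub_cancel_right]
    have h2 : (T m : k[T;T⁻¹]) = T (m - 1) * T 1 := by
      rw [← LaurentPolynomial.T_add, sub_add_cancel]
    rw [hv, h1]
    refine TrivSqZeroExt.ext ?_ ?_
    · simp only [TrivSqZeroExt.fst_mul, TrivSqZeroExt.fst_add, TrivSqZeroExt.fst_inl,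
        TrivSqZeroExt.fst_inr, add_zero, LaurentPolynomial.T_add]
    · simp only [TrivSqZeroExt.snd_mul, TrivSqZeroExt.fst_add, TrivSqZeroExt.snd_add,
        TrivSqZeroExt.fst_inl, TrivSqZeroExt.fst_inr, TrivSqZeroExt.snd_inl,
        TrivSqZeroExt.snd_inr, smul_eq_mul, op_smul_eq_mul, Int.cast_add, Int.cast_one]
      linear_combination (-(m : k[T;T⁻¹]) * F) * h2
  induction m using Int.induction_on with
  | zero => simp
  | succ i ih => rw [zpow_add_one, Units.val_mul, ih, step]
  | pred i ih =>
    rw [zpow_sub_one, Units.val_mul, ih, Units.mul_inv_eq_iff_eq_mul, step, sub_add_cancel]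

lemma fst_tUnit_zpow (F : k[T;T⁻¹]) (m : ℤ) :
    ((tUnit F ^ m : (DualNumber k[T;T⁻¹])ˣ) : DualNumber k[T;T⁻¹]).fst = T m := by
  rw [tUnit_zpow]; simp

lemma snd_tUnit_zpow (F : k[T;T⁻¹]) (m : ℤ) :
    ((tUnit F ^ m : (DualNumber k[T;T⁻¹])ˣ) : DualNumber k[T;T⁻¹]).snd =
      (m : k[T;T⁻¹]) * (T (m - 1) * F) := by
  rw [tUnit_zpow]; simp

/-- The unit `1 + d ε`. -/
def oneAddEps {R : Type*} [CommRing R] (d : R) : (DualNumber R)ˣ where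
  val := 1 + TrivSqZeroExt.inr d
  inv := 1 - TrivSqZeroExt.inr d
  val_inv := by
    linear_combination (-1 : DualNumber R) * TrivSqZeroExt.inr_mul_inr R d d
  inv_val := by
    linear_combination (-1 : DualNumber R) * TrivSqZeroExt.inr_mul_inr R d d

/-- The transition function `(t + F η)^m (1 + G η)`. -/
def transition {g : ℕ} (F : k[T;T⁻¹]) (m : ℤ) (G : Fin g → k) : (DualNumber k[T;T⁻¹])ˣ :=
  tUnit F ^ m * oneAddEps (tail G)

lemma transition_val {g : ℕ} (F : k[T;T⁻¹]) (m : ℤ) (G : Fin g → k) :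
    (transition F m G : DualNumber k[T;T⁻¹]) =
      ((tUnit F ^ m : (DualNumber k[T;T⁻¹])ˣ) : DualNumber k[T;T⁻¹]) *
        (1 + TrivSqZeroExt.inr (tail G)) := rfl

lemma fst_transition {g : ℕ} (F : k[T;T⁻¹]) (m : ℤ) (G : Fin g → k) :
    (transition F m G : DualNumber k[T;T⁻¹]).fst = T m := by
  rw [transition_val, TrivSqZeroExt.fst_mul, fst_tUnit_zpow]; simp

lemma snd_transition {g : ℕ} (F : k[T;T⁻¹]) (m : ℤ) (G : Fin g → k) :
    (transition F m G : DualNumber k[T;T⁻¹]).snd =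
      T m * tail G + (m : k[T;T⁻¹]) * (T (m - 1) * F) := by
  rw [transition_val, TrivSqZeroExt.snd_mul, fst_tUnit_zpow, snd_tUnit_zpow]; simp

lemma fst_aeval_tUnit_inv (F : k[T;T⁻¹]) (p : k[X]) :
    (Polynomial.aeval (((tUnit F)⁻¹ : (DualNumber k[T;T⁻¹])ˣ) : DualNumber k[T;T⁻¹]) p).fst =
      invert (toLaurent p) := by
  have : (TrivSqZeroExt.fstHom k k[T;T⁻¹] k[T;T⁻¹]).comp
      (Polynomial.aeval (((tUnit F)⁻¹ : (DualNumber k[T;T⁻¹])ˣ) : DualNumber k[T;T⁻¹])) =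
        (invert (R := k)).toAlgHom.comp Polynomial.toLaurentAlg := by
    ext; simp [tUnit]
  exact DFunLike.congr_fun this p

lemma fst_rho₁ (g : ℕ) (F : k[T;T⁻¹]) (y : DualNumber k[X]) :
    (rho₁ g F y).fst = invert (toLaurent y.fst) := by
  rw [rho₁, dualEval_apply, TrivSqZeroExt.fst_add, fst_aeval_tUnit_inv]; simp

lemma snd_rho₁ (g : ℕ) (F : k[T;T⁻¹]) (y : DualNumber k[X]) :
    (rho₁ g F y).snd =
      (Polynomial.aeval (((tUnit F)⁻¹ : (DualNumber k[T;T⁻¹])ˣ) : DualNumber k[T;T⁻¹]) y.fst).snd +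
        invert (toLaurent y.snd) * T (-(g : ℤ) - 1) := by
  rw [rho₁, dualEval_apply, TrivSqZeroExt.snd_add, TrivSqZeroExt.snd_mul, fst_aeval_tUnit_inv]
  simp

lemma rho₂_apply (y : DualNumber k[X]) :
    rho₂ y = TrivSqZeroExt.inl (toLaurent y.fst) + TrivSqZeroExt.inr (toLaurent y.snd) := by
  have h : ∀ p : k[X], Polynomial.aeval (TrivSqZeroExt.inl (T 1) : DualNumber k[T;T⁻¹]) p =
      TrivSqZeroExt.inl (toLaurent p) := by
    intro p
    have : Polynomial.aeval (TrivSqZeroExt.inl (T 1) : DualNumber k[T;T⁻¹]) =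
        (TrivSqZeroExt.inlAlgHom k k[T;T⁻¹] k[T;T⁻¹]).comp Polynomial.toLaurentAlg := by
      ext <;> simp
    exact DFunLike.congr_fun this p
  rw [rho₂, dualEval_apply, h, h]
  congr 1
  refine TrivSqZeroExt.ext ?_ ?_ <;> simp

/-- The Čech differential of the line bundle with transition function `u`. -/
def cech (g : ℕ) (F : k[T;T⁻¹]) (u : DualNumber k[T;T⁻¹]) :
    DualNumber k[X] × DualNumber k[X] →ₗ[k] DualNumber k[T;T⁻¹] :=
  (LinearMap.mulRight k u ∘ₗ (rho₁ g F).toLinearMap) ∘ₗ LinearMap.fst k _ _ -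
    (rho₂ (k := k)).toLinearMap ∘ₗ LinearMap.snd k _ _

lemma cech_apply (g : ℕ) (F : k[T;T⁻¹]) (u : DualNumber k[T;T⁻¹])
    (x : DualNumber k[X] × DualNumber k[X]) : cech g F u x = rho₁ g F x.1 * u - rho₂ x.2 := rfl

/-- The off-diagonal part of the Čech differential with respect to the filtration by powers of
the nilradical. -/
def cechOff (F : k[T;T⁻¹]) (u : DualNumber k[T;T⁻¹]) : k[X] × k[X] →ₗ[k] k[T;T⁻¹] :=
  (TrivSqZeroExt.sndHom k[T;T⁻¹] k[T;T⁻¹]).restrictScalars k ∘ₗ LinearMap.mulRight k u ∘ₗ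
    (Polynomial.aeval (((tUnit F)⁻¹ : (DualNumber k[T;T⁻¹])ˣ) :
      DualNumber k[T;T⁻¹])).toLinearMap ∘ₗ LinearMap.fst k _ _

lemma cechOff_apply (F : k[T;T⁻¹]) (u : DualNumber k[T;T⁻¹]) (x : k[X] × k[X]) :
    cechOff F u x = (Polynomial.aeval
      (((tUnit F)⁻¹ : (DualNumber k[T;T⁻¹])ˣ) : DualNumber k[T;T⁻¹]) x.1 * u).snd := rfl

/-- The components of a pair of dual numbers. -/
def pairComponents (R : Type*) [CommRing R] [Algebra k R] :
    (DualNumber R × DualNumber R) ≃ₗ[k] (R × R) × (R × R) where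
  toFun x := ((x.1.fst, x.2.fst), (x.1.snd, x.2.snd))
  invFun y := ((y.1.1, y.2.1), (y.1.2, y.2.2))
  left_inv _ := rfl
  right_inv _ := rfl
  map_add' _ _ := rfl
  map_smul' _ _ := rfl

/-- The components of a dual number. -/
def components (R : Type*) [CommRing R] [Algebra k R] : DualNumber R ≃ₗ[k] R × R where
  toFun x := (x.fst, x.snd)
  invFun y := (y.1, y.2)
  left_inv _ := rfl
  right_inv _ := rfl
  map_add' _ _ := rfl
  map_smul' _ _ := rfl

/-- Modulo the nilradical, `s` becomes `t⁻¹` and `u` becomes `t^m`, which gives `𝒪(m)`. On the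
nilradical, `ε = t^{-g-1} η` shifts this to `𝒪(m-g-1)`. The remaining term is the `η`-coefficient of
`a(s) u`, which depends only on the reduced part of the cochain. -/
lemma components_cech (g : ℕ) (F : k[T;T⁻¹]) {m : ℤ} {u : DualNumber k[T;T⁻¹]}
    (hu : u.fst = T m) (x : DualNumber k[X] × DualNumber k[X]) :
    components (k := k) k[T;T⁻¹] (cech g F u x) =
      (lineCech m (pairComponents (k := k) k[X] x).1,
        lineCech (m - g - 1) (pairComponents (k := k) k[X] x).2 +
          cechOff F u (pairComponents (k := k) k[X] x).1) := by
  refine Prod.ext ?_ ?_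
  · change (cech g F u x).fst = lineCech m (x.1.fst, x.2.fst)
    rw [cech_apply, lineCech_apply, TrivSqZeroExt.fst_sub, TrivSqZeroExt.fst_mul, fst_rho₁, hu,
      rho₂_apply]
    simp
  · change (cech g F u x).snd = lineCech (m - g - 1) (x.1.snd, x.2.snd) +
      cechOff F u (x.1.fst, x.2.fst)
    rw [cech_apply, lineCech_apply, cechOff_apply, TrivSqZeroExt.snd_sub, TrivSqZeroExt.snd_mul,
      TrivSqZeroExt.snd_mul, fst_rho₁, snd_rho₁, hu, rho₂_apply, fst_aeval_tUnit_inv]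
    have h : (T (m - g - 1) : k[T;T⁻¹]) = T (-(g : ℤ) - 1) * T m := by
      rw [← LaurentPolynomial.T_add]; congr 1; ring
    simp only [smul_eq_mul, op_smul_eq_mul, TrivSqZeroExt.snd_add, TrivSqZeroExt.snd_inl,
      TrivSqZeroExt.snd_inr, h]
    ring

/-- The connecting map of the Čech complexes of the nilradical part and of the reduced part. -/
def connecting (F : k[T;T⁻¹]) (m : ℤ) (N M : ℕ) (u : DualNumber k[T;T⁻¹]) :
    (Fin N → k) →ₗ[k] (Fin M → k) :=
  tailCoeff M ∘ₗ cechOff F u ∘ₗ lineKer N m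

/-- The summand `(m - g).toNat` is `h⁰(𝒪(m-g-1))`; in the cokernel its counterpart `(-m - 1).toNat`
is `h¹(𝒪(m))`. -/
lemma finrank_ker_cech (g : ℕ) (F : k[T;T⁻¹]) {m : ℤ} {u : DualNumber k[T;T⁻¹]}
    (hu : u.fst = T m) {N M : ℕ} (hN : N = (m + 1).toNat) (hM : M = (g - m).toNat) :
    Module.finrank k (LinearMap.ker (cech g F u)) =
      (m - g).toNat + Module.finrank k (LinearMap.ker (connecting F m N M u)) := by
  rw [finrank_ker_blockTriangular (lineCech (m - g - 1)) (lineCech m) (cechOff F u) (cech g F u)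
    (pairComponents k[X]) (components k[T;T⁻¹]) (components_cech g F hu)
    (lineKer (m - g).toNat (m - g - 1)) (lineKer_injective _ _) (range_lineKer (by congr 1; ring))
    (lineKer N m) (lineKer_injective _ _) (range_lineKer hN)
    (tailCoeff M) (ker_tailCoeff (by rw [hM]; congr 1; ring)), Module.finrank_fin_fun]
  rfl

lemma finrank_coker_cech (g : ℕ) (F : k[T;T⁻¹]) {m : ℤ} {u : DualNumber k[T;T⁻¹]}
    (hu : u.fst = T m) {N M : ℕ} (hN : N = (m + 1).toNat) (hM : M = (g - m).toNat) :
    Module.finrank k (DualNumber k[T;T⁻¹] ⧸ LinearMap.range (cech g F u)) =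
      (-m - 1).toNat + Module.finrank k
        ((Fin M → k) ⧸ LinearMap.range (connecting F m N M u)) := by
  rw [finrank_coker_blockTriangular (lineCech (m - g - 1)) (lineCech m) (cechOff F u) (cech g F u)
    (pairComponents k[X]) (components k[T;T⁻¹]) (components_cech g F hu)
    (lineKer N m) (range_lineKer hN)
    (tailCoeff M) (tailCoeff_surjective M) (ker_tailCoeff (by rw [hM]; congr 1; ring))
    (tailCoeff (-m - 1).toNat) (tailCoeff_surjective _) (ker_tailCoeff rfl),
    Module.finrank_fin_fun]
  rfl

/-- The Euler characteristic of the line bundle with transition function `u`. -/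
lemma index_cech (g : ℕ) (F : k[T;T⁻¹]) {m : ℤ} {u : DualNumber k[T;T⁻¹]} (hu : u.fst = T m) :
    (Module.finrank k (LinearMap.ker (cech g F u)) : ℤ) -
      (Module.finrank k (DualNumber k[T;T⁻¹] ⧸ LinearMap.range (cech g F u)) : ℤ) =
        2 * m + 1 - g := by
  rw [finrank_ker_cech g F hu rfl rfl, finrank_coker_cech g F hu rfl rfl]
  have h1 := LinearMap.finrank_range_add_finrank_ker
    (connecting F m (m + 1).toNat (g - m).toNat u)
  have h2 := Submodule.finrank_quotient_add_finrank
    (LinearMap.range (connecting F m (m + 1).toNat (g - m).toNat u))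
  rw [Module.finrank_fin_fun] at h1 h2
  -- The rank of the connecting map cancels, and truncated terms recombine by `x.toNat - (-x).toNat
  -- = x`, for `x = m + 1` and `x = m - g`.
  omega

/-- The basis section `t^l` of `𝒪(n)` is `s^{n-l}` on `U₁`. As `s = (t + Fη)⁻¹`, multiplying by the
transition function lowers the exponent `n` to `l`, and the `η`-coefficient of `(t + Fη)^l (1 + Gη)`
is read off. -/
lemma connecting_transition {g n : ℕ} (F : Fin (g - 2) → k) (G : Fin g → k) :
    connecting (tail F) n (n + 1) (g - n) (transition (tail F) n G) =
      (matrixA n F G).mulVecLin := by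
  refine LinearMap.ext fun v => funext fun i => ?_
  rw [Matrix.mulVecLin_apply, Matrix.mulVec, dotProduct]
  change tailCoeff _ (cechOff _ _ (lineKer _ _ v)) i = _
  rw [cechOff_apply, lineKer_apply]
  simp only [map_sum, Finset.sum_mul, TrivSqZeroExt.snd_sum, Finset.sum_apply]
  refine Finset.sum_congr rfl fun l _ => ?_
  have h1 : Polynomial.aeval (((tUnit (tail F))⁻¹ : (DualNumber k[T;T⁻¹])ˣ) : DualNumber k[T;T⁻¹])
      (Polynomial.monomial ((n : ℤ) - l).toNat (v l)) * (transition (tail F) n G) =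
        v l • (transition (tail F) l G : DualNumber k[T;T⁻¹]) := by
    have h : ((tUnit (tail F) ^ (l : ℤ) : (DualNumber k[T;T⁻¹])ˣ) : DualNumber k[T;T⁻¹]) =
        (((tUnit (tail F))⁻¹ : (DualNumber k[T;T⁻¹])ˣ) : DualNumber k[T;T⁻¹]) ^
          ((n : ℤ) - l).toNat * ((tUnit (tail F) ^ (n : ℤ) : (DualNumber k[T;T⁻¹])ˣ) :
            DualNumber k[T;T⁻¹]) := by
      rw [← Units.val_pow_eq_pow_val, ← Units.val_mul, inv_pow, ← zpow_natCast, ← zpow_neg,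
        ← zpow_add]
      congr 2
      have := l.2
      omega
    rw [Polynomial.aeval_monomial, transition_val, transition_val, h, Algebra.smul_def]
    ring
  rw [h1, TrivSqZeroExt.snd_smul, map_smul, Pi.smul_apply, smul_eq_mul, mul_comm, snd_transition,
    tailCoeff_apply, AddMonoidAlgebra.coeff_add, Finsupp.add_apply, matrixA, Matrix.of_apply]
  congr 2
  -- Row `i`, counted from zero, is the coefficient of `t^{-(i+1)}`: it picks index `i + l + 1` in
  -- `t^l G`, and index `i + l` in `t^{l-1} F` below.
  · rw [LaurentPolynomial.T_mul, coeff_mul_T, coeff_tail]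
    congr 1; omega
  · rw [LaurentPolynomial.T_mul, ← zsmul_eq_mul, AddMonoidAlgebra.coeff_smul, Finsupp.smul_apply,
      coeff_mul_T, coeff_tail, zsmul_eq_mul, Int.cast_natCast]
    congr 2; omega

/-- For `n ≤ g` the nilradical part `𝒪(n-g-1)` has no sections, so the sections are the kernel of
`A_F(G)` on `k^{n+1}`. -/
lemma finrank_ker_cech_transition {g n : ℕ} (hn : n ≤ g) (F : Fin (g - 2) → k) (G : Fin g → k) :
    Module.finrank k (LinearMap.ker (cech g (tail F) (transition (tail F) n G))) +
      (matrixA n F G).rank = n + 1 := by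
  rw [finrank_ker_cech g _ (fst_transition (tail F) n G) (N := n + 1) (M := g - n) (by omega)
    (by omega), connecting_transition]
  have := LinearMap.finrank_range_add_finrank_ker (matrixA n F G).mulVecLin
  rw [Module.finrank_fin_fun] at this
  rw [Matrix.rank]
  omega

end Transition

/-! ### Normal form of transition functions modulo units of the charts. -/

section NormalForm

open Polynomial (toLaurent)
open LaurentPolynomial (T invert)

variable {k : Type u} [Field k]

/-- After clearing denominators, the unit and its inverse become polynomials with product a power of
`X`. Since `X` is prime, each is a constant times a power of `X`. -/
lemma exists_eq_C_mul_T_of_isUnit {f : k[T;T⁻¹]} (hf : IsUnit f) :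
    ∃ (c : k) (m : ℤ), c ≠ 0 ∧ f = LaurentPolynomial.C c * T m := by
  obtain ⟨f', hf'⟩ := hf.exists_right_inv
  obtain ⟨a, p, hp⟩ := LaurentPolynomial.exists_T_pow f
  obtain ⟨b, q, hq⟩ := LaurentPolynomial.exists_T_pow f'
  have hpq : p * q = Polynomial.X ^ (a + b) := by
    apply Polynomial.toLaurent_injective
    rw [map_mul, hp, hq, Polynomial.toLaurent_X_pow, Nat.cast_add, LaurentPolynomial.T_add]
    linear_combination (T (a : ℤ) * T (b : ℤ) : k[T;T⁻¹]) * hf'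
  obtain ⟨i, -, hi⟩ := (dvd_prime_pow Polynomial.prime_X (a + b)).mp (Dvd.intro q hpq)
  obtain ⟨w, hw⟩ := hi.symm
  obtain ⟨c, hc, hcw⟩ := Polynomial.isUnit_iff.mp w.isUnit
  refine ⟨c, i - a, hc.ne_zero, ?_⟩
  rw [LaurentPolynomial.T_sub, ← Polynomial.toLaurent_C, hcw, ← Polynomial.toLaurent_X_pow,
    ← mul_assoc, ← map_mul, mul_comm (w : k[X]), hw, hp, mul_assoc, ← LaurentPolynomial.T_add,
    add_neg_cancel, LaurentPolynomial.T_zero, mul_one]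

lemma aeval_C_snd (x : DualNumber k[T;T⁻¹]) (c : k) :
    (Polynomial.aeval x (Polynomial.C c)).snd = 0 := by
  rw [Polynomial.aeval_C]; rfl

/-- Every transition function is equivalent to a standard one. -/
lemma exists_transition (g : ℕ) (F : k[T;T⁻¹]) (u : (DualNumber k[T;T⁻¹])ˣ) :
    ∃ (m : ℤ) (G : Fin g → k) (v₁ v₂ : (DualNumber k[X])ˣ),
      rho₁ g F (v₁ : DualNumber k[X]) * (u : DualNumber k[T;T⁻¹]) =
        (transition F m G : DualNumber k[T;T⁻¹]) * rho₂ (v₂ : DualNumber k[X]) := by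
  obtain ⟨c, m, hc, hu⟩ := exists_eq_C_mul_T_of_isUnit
    (TrivSqZeroExt.isUnit_iff_isUnit_fst.mp u.isUnit)
  set z : (DualNumber k[T;T⁻¹])ˣ := (tUnit F ^ m)⁻¹ * u with hz
  have huz : u = tUnit F ^ m * z := by rw [hz, mul_inv_cancel_left]
  have hz1 : (z : DualNumber k[T;T⁻¹]).fst = LaurentPolynomial.C c := by
    have h1 : (T (-m) * T m : k[T;T⁻¹]) = 1 := by
      rw [← LaurentPolynomial.T_add, neg_add_cancel, LaurentPolynomial.T_zero]
    rw [hz, ← zpow_neg, Units.val_mul, TrivSqZeroExt.fst_mul, fst_tUnit_zpow, hu]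
    linear_combination LaurentPolynomial.C c * h1
  set B : k[T;T⁻¹] := LaurentPolynomial.C c⁻¹ * (z : DualNumber k[T;T⁻¹]).snd with hB
  have hcB : (z : DualNumber k[T;T⁻¹]).snd = LaurentPolynomial.C c * B := by
    rw [hB, ← mul_assoc, ← map_mul, mul_inv_cancel₀ hc, map_one, one_mul]
  -- A series with no coefficients at `t⁻¹, …, t^{-g}` is a coboundary for `𝒪(-g-1)`. The resulting
  -- `a`, `b` are the `ε`- and `η`-parts of the chart units that reduce `B` to its tail; the
  -- constant `c` is absorbed on `U₂`.
  obtain ⟨⟨a, b⟩, hab⟩ : B - tail (tailCoeff g B) ∈ LinearMap.range (lineCech (-(g : ℤ) - 1)) := by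
    rw [← ker_tailCoeff (N := g) (by omega), LinearMap.mem_ker, map_sub, tailCoeff_tail, sub_self]
  rw [lineCech_apply] at hab
  refine ⟨m, tailCoeff g B, oneAddEps (-a),
    Units.map (algebraMap k (DualNumber k[X]) : k →* DualNumber k[X]) (Units.mk0 c hc) *
      oneAddEps (-b), ?_⟩
  rw [transition_val, huz, Units.val_mul, mul_left_comm, mul_assoc]
  congr 1
  have h2 : rho₂ ((Units.map (algebraMap k (DualNumber k[X]) : k →* DualNumber k[X])
      (Units.mk0 c hc) * oneAddEps (-b) : (DualNumber k[X])ˣ) : DualNumber k[X]) =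
      TrivSqZeroExt.inl (LaurentPolynomial.C c) * (1 - TrivSqZeroExt.inr (toLaurent b)) := by
    change rho₂ (algebraMap k (DualNumber k[X]) c * (1 + TrivSqZeroExt.inr (-b))) = _
    rw [map_mul, AlgHom.commutes, rho₂_apply]
    congr 1
    refine TrivSqZeroExt.ext ?_ ?_ <;> simp
  have h1 : rho₁ g F ((oneAddEps (-a) : (DualNumber k[X])ˣ) : DualNumber k[X]) =
      1 - TrivSqZeroExt.inr (invert (toLaurent a) * T (-(g : ℤ) - 1)) := by
    change rho₁ g F (1 + TrivSqZeroExt.inr (-a)) = _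
    refine TrivSqZeroExt.ext ?_ ?_
    · rw [fst_rho₁]; simp
    · rw [snd_rho₁, TrivSqZeroExt.fst_add, TrivSqZeroExt.fst_one, TrivSqZeroExt.fst_inr, add_zero,
        ← Polynomial.C_1, aeval_C_snd]
      simp
  rw [h1, h2]
  refine TrivSqZeroExt.ext ?_ ?_
  · simp [hz1]
  · simp only [TrivSqZeroExt.snd_mul, TrivSqZeroExt.fst_add, TrivSqZeroExt.fst_sub,
      TrivSqZeroExt.snd_add, TrivSqZeroExt.snd_sub, TrivSqZeroExt.fst_inl, TrivSqZeroExt.fst_mul,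
      TrivSqZeroExt.fst_inr, TrivSqZeroExt.snd_inl, TrivSqZeroExt.snd_inr, TrivSqZeroExt.fst_one,
      TrivSqZeroExt.snd_one, smul_eq_mul, op_smul_eq_mul, hz1, hcB]
    linear_combination (-LaurentPolynomial.C c) * hab

/-- Equivalent standard transition functions are equal. -/
lemma transition_injective {g : ℕ} (F : k[T;T⁻¹]) (m : ℤ) {G G' : Fin g → k}
    (v₁ v₂ : (DualNumber k[X])ˣ)
    (h : rho₁ g F (v₁ : DualNumber k[X]) * (transition F m G : DualNumber k[T;T⁻¹]) =
      (transition F m G' : DualNumber k[T;T⁻¹]) * rho₂ (v₂ : DualNumber k[X])) : G = G' := by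
  rw [transition_val, transition_val, mul_left_comm, mul_assoc] at h
  replace h := (tUnit F ^ m).isUnit.mul_left_cancel h
  -- The reductions of chart units are constants, and a constant acquires no `η`-part when `s` is
  -- expanded. So `F` drops out of the comparison.
  obtain ⟨c₁, hc₁, h₁⟩ := Polynomial.isUnit_iff.mp
    (TrivSqZeroExt.isUnit_iff_isUnit_fst.mp v₁.isUnit)
  obtain ⟨c₂, -, h₂⟩ := Polynomial.isUnit_iff.mp
    (TrivSqZeroExt.isUnit_iff_isUnit_fst.mp v₂.isUnit)
  have hf := congrArg TrivSqZeroExt.fst h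
  have hs := congrArg TrivSqZeroExt.snd h
  simp only [TrivSqZeroExt.snd_mul, TrivSqZeroExt.fst_add, TrivSqZeroExt.snd_add,
    TrivSqZeroExt.fst_inl, TrivSqZeroExt.fst_mul, TrivSqZeroExt.fst_inr, TrivSqZeroExt.snd_inl,
    TrivSqZeroExt.snd_inr, TrivSqZeroExt.fst_one, TrivSqZeroExt.snd_one, smul_eq_mul,
    op_smul_eq_mul, fst_rho₁, snd_rho₁, rho₂_apply, ← h₁, ← h₂, aeval_C_snd,
    Polynomial.toLaurent_C, LaurentPolynomial.invert_C, add_zero, zero_add, mul_one,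
    one_mul] at hf hs
  -- The first components give `c₁ = c₂`; the second then show that `c₁ (G' - G)` is a coboundary
  -- for `𝒪(-g-1)`, so its tail vanishes.
  have key : c₁ • (tail G' - tail G) =
      lineCech (-(g : ℤ) - 1) ((v₁ : DualNumber k[X]).snd, (v₂ : DualNumber k[X]).snd) := by
    rw [lineCech_apply, LaurentPolynomial.smul_eq_C_mul]
    linear_combination -hs + tail G' * hf
  have h0 : c₁ • (tail G' - tail G) ∈ LinearMap.ker (tailCoeff (k := k) g) := by
    rw [ker_tailCoeff (N := g) (d := -(g : ℤ) - 1) (by omega), key]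
    exact LinearMap.mem_range_self _ _
  rw [LinearMap.mem_ker, map_smul, map_sub, tailCoeff_tail, tailCoeff_tail,
    smul_eq_zero_iff_right hc₁.ne_zero, sub_eq_zero] at h0
  exact h0.symm

end NormalForm

/-! ## Determinantal loci -/

section Determinantal

/-- The row space has a basis consisting of rows; the first `s` of them are independent. Applying
this to rows and then to columns yields a nonzero minor. -/
lemma exists_rows_of_le_rank {m n K : Type*} [Field K] [Finite m] [Fintype n] (A : Matrix m n K)
    {s : ℕ} (hs : s ≤ A.rank) : ∃ e : Fin s → m, (A.submatrix e id).rank = s := by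
  obtain ⟨f, hf, -, hli⟩ := Submodule.exists_fun_fin_finrank_span_eq K (Set.range A.row)
  choose e he using hf
  rw [A.rank_eq_finrank_span_row] at hs
  refine ⟨e ∘ Fin.castLE hs, ?_⟩
  have h : LinearIndependent K (A.submatrix (e ∘ Fin.castLE hs) id).row := by
    have h1 : (A.submatrix (e ∘ Fin.castLE hs) id).row = f ∘ Fin.castLE hs :=
      funext fun i => he (Fin.castLE hs i)
    rw [h1]
    exact hli.comp _ (Fin.castLE_injective hs)
  rw [h.rank_matrix, Fintype.card_fin]

/-- The rank of a matrix is at least `s` if and only if some minor of size `s` does not vanish. -/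
lemma le_rank_iff_exists_minor {m n K : Type*} [Field K] [Finite m] [Fintype n] (A : Matrix m n K)
    (s : ℕ) : s ≤ A.rank ↔ ∃ (e : Fin s → m) (f : Fin s → n), (A.submatrix e f).det ≠ 0 := by
  constructor
  · intro hs
    obtain ⟨e, he⟩ := exists_rows_of_le_rank A hs
    obtain ⟨f, hf⟩ := exists_rows_of_le_rank (A.submatrix e id).transpose (s := s)
      (by rw [Matrix.rank_transpose, he])
    refine ⟨e, f, fun h => ?_⟩
    have h2 : (A.submatrix e f).rank = s := by
      rw [← Matrix.rank_transpose]
      exact hf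
    have h3 : LinearIndependent K (A.submatrix e f).row := by
      rw [linearIndependent_iff_card_eq_finrank_span, Set.finrank,
        ← Matrix.rank_eq_finrank_span_row, h2, Fintype.card_fin]
    rw [Matrix.linearIndependent_rows_iff_isUnit, Matrix.isUnit_iff_isUnit_det, h] at h3
    exact not_isUnit_zero h3
  · rintro ⟨e, f, h⟩
    have h1 : IsUnit (A.submatrix e f) :=
      (Matrix.isUnit_iff_isUnit_det _).mpr (isUnit_iff_ne_zero.mpr h)
    calc s = (A.submatrix e f).rank := by rw [Matrix.rank_of_isUnit _ h1, Fintype.card_fin]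
      _ ≤ A.rank := Matrix.rank_submatrix_le A e f

/-- The generic matrix `A_F`, with the coordinates of `G` as variables. -/
def genericMatrixA {k : Type u} [Field k] {g : ℕ} (n : ℕ) (F : Fin (g - 2) → k) :
    Matrix (Fin (g - n)) (Fin (n + 1)) (MvPolynomial (Fin g) k) :=
  Matrix.of fun i j =>
    entry (MvPolynomial.X : Fin g → MvPolynomial (Fin g) k) ((i : ℕ) + j + 1) +
      MvPolynomial.C (((j : ℕ) : k) * entry F ((i : ℕ) + j))

lemma aeval_genericMatrixA {k : Type u} [Field k] {g : ℕ} (n : ℕ) (F : Fin (g - 2) → k)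
    (G : Fin g → k) : (genericMatrixA n F).map (MvPolynomial.aeval G) = matrixA n F G := by
  ext i j
  simp only [genericMatrixA, matrixA, Matrix.map_apply, Matrix.of_apply, map_add,
    MvPolynomial.aeval_C, Algebra.algebraMap_self, RingHom.id_apply]
  congr 1
  unfold entry
  split_ifs
  · exact MvPolynomial.aeval_X _ _
  · exact map_zero _

/-- The loci `rank A_F(G) ≤ n - r` are algebraic sets. -/
lemma exists_locus_eq_zeroLocus {k : Type u} [Field k] {g : ℕ} (n r : ℕ) (F : Fin (g - 2) → k) :
    ∃ I : Ideal (MvPolynomial (Fin g) k), locus n r F = MvPolynomial.zeroLocus k I := by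
  -- For `r > n` the bound `n - r` is negative, so the locus is empty and the unit ideal is used.
  -- Otherwise the subtraction `n - r` in `ℕ` is exact and the minors of size `n - r + 1` generate.
  rcases lt_or_ge n r with h | h
  · refine ⟨⊤, ?_⟩
    ext G
    rw [MvPolynomial.mem_zeroLocus_iff]
    constructor
    · intro hG
      have hG : ((matrixA n F G).rank : ℤ) ≤ (n : ℤ) - r := hG
      omega
    · intro hG
      have := hG 1 Submodule.mem_top
      simp at this
  · refine ⟨Ideal.span {d | ∃ (e : Fin (n - r + 1) → Fin (g - n)) (f : Fin (n - r + 1) → Fin (n + 1)),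
      ((genericMatrixA n F).submatrix e f).det = d}, ?_⟩
    ext G
    have h1 : G ∈ locus n r F ↔ ¬ (n - r + 1 ≤ (matrixA n F G).rank) := by
      change ((matrixA n F G).rank : ℤ) ≤ (n : ℤ) - r ↔ _
      omega
    have h2 : ∀ (e : Fin (n - r + 1) → Fin (g - n)) (f : Fin (n - r + 1) → Fin (n + 1)),
        MvPolynomial.aeval G ((genericMatrixA n F).submatrix e f).det =
          ((matrixA n F G).submatrix e f).det := by
      intro e f
      rw [AlgHom.map_det, ← aeval_genericMatrixA]
      rfl
    rw [h1, le_rank_iff_exists_minor, MvPolynomial.mem_zeroLocus_iff]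
    push Not
    constructor
    · intro hG p hp
      refine (Ideal.span_le (I := RingHom.ker (MvPolynomial.aeval (R := k) G))).mpr ?_ hp
      rintro _ ⟨e, f, rfl⟩
      exact (h2 e f).trans (hG e f)
    · intro hG e f
      rw [← h2]
      exact hG _ (Ideal.subset_span ⟨e, f, rfl⟩)

end Determinantal

/-! ## Line bundles on a ribbon -/

section RibbonBundles

variable {k : Type u} [Field k] {C : Scheme.{u}} {π : C ⟶ Spec (CommRingCat.of k)}

lemma fres_scalar (π : C ⟶ Spec (CommRingCat.of k)) {U V : C.Opens} (h : V ≤ U) (c : k) :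
    fres h (scalar π U c) = scalar π V c :=
  fres_fres le_top h (π.appTop ((Scheme.ΓSpecIso (CommRingCat.of k)).inv c))

variable (C) in
/-- The structure sheaf as a module over itself. -/
def structureModule : C.Modules :=
  (SheafOfModules.unit C.ringCatSheaf : SheafOfModules C.ringCatSheaf)

lemma isFrame_one (U : C.Opens) :
    IsFrame (structureModule C) U (1 : Γ(C, U)) := by
  intro V h
  have key : ∀ f : Γ(C, V),
      (f • res (structureModule C) h (1 : Γ(C, U)) : Γ(C, V)) = f :=
    fun f => (congrArg (f * ·) (map_one (fres h))).trans (mul_one f)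
  exact (congrArg Function.Bijective (funext key)).mpr Function.bijective_id

lemma isoClass_eq_iff {L M : C.Modules} : isoClass L = isoClass M ↔ Nonempty (L ≅ M) :=
  Quotient.eq

namespace Gluing

variable {g : ℕ} {F : Fin (g - 2) → k} (D : Gluing π g F)

lemma φ₁₂_fres_left (f : Γ(C, D.U₁)) :
    D.φ₁₂ (fres inf_le_left f) = rho₁ g (tail F) (D.φ₁ f) := D.res₁ f

lemma φ₁₂_fres_right (f : Γ(C, D.U₂)) :
    D.φ₁₂ (fres inf_le_right f) = rho₂ (D.φ₂ f) := D.res₂ f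

lemma φ₁₂_scalar (c : k) :
    D.φ₁₂ (scalar π (D.U₁ ⊓ D.U₂) c) = algebraMap k (DualNumber k[T;T⁻¹]) c := by
  rw [← fres_scalar π (inf_le_right : D.U₁ ⊓ D.U₂ ≤ D.U₂), φ₁₂_fres_right, D.scalar₂,
    AlgHom.commutes]

variable {L : C.Modules} {e₁ : Γ(L, D.U₁)} {e₂ : Γ(L, D.U₂)} {u : DualNumber k[T;T⁻¹]}

lemma mem_ker_cech_iff (a : Γ(C, D.U₁)) (b : Γ(C, D.U₂)) :
    (D.φ₁ a, D.φ₂ b) ∈ LinearMap.ker (cech g (tail F) u) ↔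
      fres (inf_le_left : D.U₁ ⊓ D.U₂ ≤ D.U₁) a * D.φ₁₂.symm u = fres inf_le_right b := by
  rw [LinearMap.mem_ker, cech_apply, sub_eq_zero, ← φ₁₂_fres_left, ← φ₁₂_fres_right,
    ← D.φ₁₂.injective.eq_iff, map_mul, RingEquiv.apply_symm_apply]

/-- In the two frames a global section is a pair of functions, and the gluing condition on the
overlap is membership in the kernel of `cech`. -/
lemma h0_eq_finrank_ker_cech (he₁ : IsFrame L D.U₁ e₁) (he₂ : IsFrame L D.U₂ e₂)
    (hu : res L (inf_le_left : D.U₁ ⊓ D.U₂ ≤ D.U₁) e₁ = D.φ₁₂.symm u • res L inf_le_right e₂) :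
    h0 π L = Module.finrank k (LinearMap.ker (cech g (tail F) u)) := by
  let := sectionsModule π L ⊤
  have hsmul : ∀ (c : k) (x : Γ(L, ⊤)), c • x = scalar π ⊤ c • x := fun _ _ => rfl
  let f : Γ(L, ⊤) →ₗ[k] DualNumber k[X] × DualNumber k[X] :=
    { toFun := fun x => (D.φ₁ (he₁.coord le_rfl (res L le_top x)),
        D.φ₂ (he₂.coord le_rfl (res L le_top x)))
      map_add' := fun x y => by simp only [res_add, map_add, Prod.mk_add_mk]
      map_smul' := fun c x => Prod.ext
        (by
          change D.φ₁ (he₁.coord _ (res L _ (c • x))) = c • D.φ₁ (he₁.coord _ (res L _ x))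
          rw [hsmul, res_smul, he₁.coord_smul, map_mul, fres_scalar, D.scalar₁, Algebra.smul_def])
        (by
          change D.φ₂ (he₂.coord _ (res L _ (c • x))) = c • D.φ₂ (he₂.coord _ (res L _ x))
          rw [hsmul, res_smul, he₂.coord_smul, map_mul, fres_scalar, D.scalar₂,
            Algebra.smul_def]) }
  have hcov : (⊤ : C.Opens) ≤ D.U₁ ⊔ D.U₂ := D.cover.ge
  have hinj : Function.Injective f := by
    intro x y hxy
    refine res_ext₂ le_top le_top hcov ?_ ?_
    · exact (he₁.coord le_rfl).injective (D.φ₁.injective (congrArg Prod.fst hxy))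
    · exact (he₂.coord le_rfl).injective (D.φ₂.injective (congrArg Prod.snd hxy))
  have hrange : LinearMap.range f = LinearMap.ker (cech g (tail F) u) := by
    apply le_antisymm
    · rintro _ ⟨x, rfl⟩
      rw [show f x = (D.φ₁ (he₁.coord le_rfl (res L le_top x)),
        D.φ₂ (he₂.coord le_rfl (res L le_top x))) from rfl, mem_ker_cech_iff,
        ← he₂.coord_res, eq_comm, IsFrame.coord_eq_iff, mul_smul, res_res]
      have hx := he₁.coord_smul_res le_rfl (res L le_top x)
      rw [res_self] at hx
      rw [← hu, ← res_smul, hx, res_res]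
    · rintro ⟨a, b⟩ hab
      obtain ⟨a, rfl⟩ := D.φ₁.surjective a
      obtain ⟨b, rfl⟩ := D.φ₂.surjective b
      rw [mem_ker_cech_iff] at hab
      obtain ⟨x, hx₁, hx₂⟩ := exists_res₂ (L := L) le_top le_top hcov (a • e₁) (b • e₂) (by
        rw [res_smul, res_smul, hu, smul_smul, hab])
      refine ⟨x, Prod.ext (congrArg D.φ₁ ?_) (congrArg D.φ₂ ?_)⟩
      · rw [IsFrame.coord_eq_iff, hx₁, res_self]
      · rw [IsFrame.coord_eq_iff, hx₂, res_self]
  rw [← hrange, LinearMap.finrank_range_of_inj hinj]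
  rfl

/-- Reading sections over the overlap in the frame `e₂` carries the sum of the two images of
restriction to the range of `cech`. -/
lemma h1_eq_finrank_coker_cech (he₁ : IsFrame L D.U₁ e₁) (he₂ : IsFrame L D.U₂ e₂)
    (hu : res L (inf_le_left : D.U₁ ⊓ D.U₂ ≤ D.U₁) e₁ = D.φ₁₂.symm u • res L inf_le_right e₂) :
    D.h1 L = Module.finrank k (DualNumber k[T;T⁻¹] ⧸ LinearMap.range (cech g (tail F) u)) := by
  let := sectionsModule π L (D.U₁ ⊓ D.U₂)
  have hsmul : ∀ (c : k) (x : Γ(L, D.U₁ ⊓ D.U₂)), c • x = scalar π (D.U₁ ⊓ D.U₂) c • x := fun _ _ => rfl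
  let E : Γ(L, D.U₁ ⊓ D.U₂) ≃ₗ[k] DualNumber k[T;T⁻¹] :=
    { (he₂.coord inf_le_right).trans D.φ₁₂.toAddEquiv with
      map_smul' := fun c x => by
        change D.φ₁₂ (he₂.coord _ (c • x)) = c • D.φ₁₂ (he₂.coord _ x)
        rw [hsmul, he₂.coord_smul, map_mul, φ₁₂_scalar, Algebra.smul_def] }
  have hE : ∀ x, E x = D.φ₁₂ (he₂.coord inf_le_right x) := fun _ => rfl
  have hE₁ : ∀ a : Γ(C, D.U₁), E (res L inf_le_left (a • e₁)) = rho₁ g (tail F) (D.φ₁ a) * u := by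
    intro a
    rw [hE, ← φ₁₂_fres_left, ← D.φ₁₂.apply_symm_apply u, ← map_mul]
    congr 1
    rw [IsFrame.coord_eq_iff, res_smul, hu, mul_smul]
  have hE₂ : ∀ b : Γ(C, D.U₂), E (res L inf_le_right (b • e₂)) = rho₂ (D.φ₂ b) := by
    intro b
    rw [hE, ← φ₁₂_fres_right]
    congr 1
    rw [IsFrame.coord_eq_iff, res_smul]
  have hmap : (Submodule.span k
      (Set.range (res L (inf_le_left : D.U₁ ⊓ D.U₂ ≤ D.U₁)) ∪
        Set.range (res L (inf_le_right : D.U₁ ⊓ D.U₂ ≤ D.U₂)))).map E.toLinearMap =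
      LinearMap.range (cech g (tail F) u) := by
    apply le_antisymm
    · rw [Submodule.map_span, Submodule.span_le]
      rintro _ ⟨_, ⟨x, rfl⟩ | ⟨x, rfl⟩, rfl⟩
      · refine ⟨(D.φ₁ (he₁.coord le_rfl x), 0), ?_⟩
        rw [cech_apply, map_zero, sub_zero, ← hE₁]
        have := he₁.coord_smul_res le_rfl x
        rw [res_self] at this
        rw [this]
        rfl
      · refine ⟨(0, -D.φ₂ (he₂.coord le_rfl x)), ?_⟩
        rw [cech_apply, map_zero, zero_mul, map_neg, zero_sub, neg_neg, ← hE₂]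
        have := he₂.coord_smul_res le_rfl x
        rw [res_self] at this
        rw [this]
        rfl
    · rintro _ ⟨⟨a, b⟩, rfl⟩
      obtain ⟨a, rfl⟩ := D.φ₁.surjective a
      obtain ⟨b, rfl⟩ := D.φ₂.surjective b
      rw [cech_apply, ← hE₁, ← hE₂, ← map_sub]
      exact Submodule.mem_map_of_mem (Submodule.sub_mem _
        (Submodule.subset_span (Or.inl ⟨_, rfl⟩)) (Submodule.subset_span (Or.inr ⟨_, rfl⟩)))
  exact (Submodule.Quotient.equiv _ _ E hmap).finrank_eq

lemma chi_eq (he₁ : IsFrame L D.U₁ e₁) (he₂ : IsFrame L D.U₂ e₂)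
    (hu : res L (inf_le_left : D.U₁ ⊓ D.U₂ ≤ D.U₁) e₁ = D.φ₁₂.symm u • res L inf_le_right e₂)
    {m : ℤ} (hm : u.fst = LaurentPolynomial.T m) : D.chi L = 2 * m + 1 - g := by
  rw [chi, D.h0_eq_finrank_ker_cech he₁ he₂ hu, D.h1_eq_finrank_coker_cech he₁ he₂ hu,
    index_cech g (tail F) hm]

lemma degree_eq (he₁ : IsFrame L D.U₁ e₁) (he₂ : IsFrame L D.U₂ e₂)
    (hu : res L (inf_le_left : D.U₁ ⊓ D.U₂ ≤ D.U₁) e₁ = D.φ₁₂.symm u • res L inf_le_right e₂)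
    {m : ℤ} (hm : u.fst = LaurentPolynomial.T m) : D.degree L = 2 * m := by
  -- The structure sheaf has frames `1`, `1` and transition function `1`, the case `m = 0`.
  have h : D.chi (structureModule C) = 2 * 0 + 1 - g := by
    refine D.chi_eq (isFrame_one D.U₁) (isFrame_one D.U₂) (u := 1) ?_ ?_
    · rw [map_one, one_smul]
      exact (map_one (fres _)).trans (map_one (fres _)).symm
    · rw [TrivSqZeroExt.fst_one, LaurentPolynomial.T_zero]
  change D.chi L - D.chi (structureModule C) = _
  rw [D.chi_eq he₁ he₂ hu hm, h]
  ring

lemma hasCoordinates_iff {n : ℕ} {G : Fin g → k} : D.HasCoordinates n G L ↔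
    ∃ (e₁ : Γ(L, D.U₁)) (e₂ : Γ(L, D.U₂)), IsFrame L D.U₁ e₁ ∧ IsFrame L D.U₂ e₂ ∧
      res L (inf_le_left : D.U₁ ⊓ D.U₂ ≤ D.U₁) e₁ =
        D.φ₁₂.symm (transition (tail F) n G) • res L inf_le_right e₂ := by
  rw [transition_val, zpow_natCast, Units.val_pow_eq_pow_val]
  rfl

variable {D}

lemma HasCoordinates.degree_eq {n : ℕ} {G : Fin g → k} (h : D.HasCoordinates n G L) :
    D.degree L = 2 * n := by
  obtain ⟨e₁, e₂, he₁, he₂, hu⟩ := D.hasCoordinates_iff.mp h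
  exact D.degree_eq he₁ he₂ hu (fst_transition _ _ _)

lemma HasCoordinates.h0_add_rank {n : ℕ} (hn : n ≤ g) {G : Fin g → k}
    (h : D.HasCoordinates n G L) : h0 π L + (matrixA n F G).rank = n + 1 := by
  obtain ⟨e₁, e₂, he₁, he₂, hu⟩ := D.hasCoordinates_iff.mp h
  rw [D.h0_eq_finrank_ker_cech he₁ he₂ hu, finrank_ker_cech_transition hn]

lemma HasCoordinates.isLineBundle {n : ℕ} {G : Fin g → k} (h : D.HasCoordinates n G L) :
    IsLineBundle L := by
  obtain ⟨e₁, e₂, he₁, he₂, -⟩ := h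
  intro x
  have hx : x ∈ D.U₁ ⊔ D.U₂ := D.cover ▸ Opens.mem_top x
  rcases hx with hx | hx
  · exact ⟨_, hx, e₁, he₁⟩
  · exact ⟨_, hx, e₂, he₂⟩

lemma HasCoordinates.of_iso {M : C.Modules} {n : ℕ} {G : Fin g → k} (h : D.HasCoordinates n G L)
    (φ : L ≅ M) : D.HasCoordinates n G M := by
  obtain ⟨e₁, e₂, he₁, he₂, hu⟩ := h
  refine ⟨_, _, he₁.map_iso φ, he₂.map_iso φ, ?_⟩
  rw [← app_res, hu, Scheme.Modules.Hom.app_smul, app_res]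

/-- Two choices of frames differ by chart units, so the two standard transition functions are
equivalent and hence equal. -/
lemma HasCoordinates.unique {n : ℕ} {G G' : Fin g → k} (h : D.HasCoordinates n G L)
    (h' : D.HasCoordinates n G' L) : G = G' := by
  obtain ⟨e₁, e₂, he₁, he₂, hu⟩ := D.hasCoordinates_iff.mp h
  obtain ⟨e₁', e₂', he₁', he₂', hu'⟩ := D.hasCoordinates_iff.mp h'
  obtain ⟨v₁, rfl⟩ := he₁.exists_unit he₁'
  obtain ⟨v₂, rfl⟩ := he₂.exists_unit he₂'
  refine transition_injective (tail F) n (Units.map (D.φ₁ : Γ(C, D.U₁) →* DualNumber k[X]) v₁)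
    (Units.map (D.φ₂ : Γ(C, D.U₂) →* DualNumber k[X]) v₂) ?_
  rw [res_smul, res_smul, hu, smul_smul, smul_smul] at hu'
  have := congrArg D.φ₁₂ ((he₂ _ inf_le_right).injective hu')
  rw [map_mul, map_mul, RingEquiv.apply_symm_apply, RingEquiv.apply_symm_apply, φ₁₂_fres_left,
    φ₁₂_fres_right] at this
  exact this

variable (D)

/-- A line bundle of degree `2n` is given by coordinates. -/
lemma exists_hasCoordinates {n : ℕ} (hL : IsLineBundle L) (hd : D.degree L = 2 * n) :
    ∃ G : Fin g → k, D.HasCoordinates n G L := by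
  obtain ⟨e₁, he₁⟩ := exists_frame_of_affine D.affine₁ D.φ₁ hL
  obtain ⟨e₂, he₂⟩ := exists_frame_of_affine D.affine₂ D.φ₂ hL
  obtain ⟨w, hw⟩ := (he₂.of_le (inf_le_right : D.U₁ ⊓ D.U₂ ≤ D.U₂)).exists_unit
    (he₁.of_le inf_le_left)
  obtain ⟨m, G, v₁, v₂, hv⟩ := exists_transition g (tail F)
    (Units.map (D.φ₁₂ : Γ(C, D.U₁ ⊓ D.U₂) →* DualNumber k[T;T⁻¹]) w)
  have he₁' := he₁.smul_unit (Units.map (D.φ₁.symm : DualNumber k[X] →* Γ(C, D.U₁)) v₁)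
  have he₂' := he₂.smul_unit (Units.map (D.φ₂.symm : DualNumber k[X] →* Γ(C, D.U₂)) v₂)
  have hw' : fres (inf_le_left : D.U₁ ⊓ D.U₂ ≤ D.U₁) (D.φ₁.symm v₁) * (w : Γ(C, D.U₁ ⊓ D.U₂)) =
      D.φ₁₂.symm (transition (tail F) m G) * fres inf_le_right (D.φ₂.symm v₂) := by
    apply D.φ₁₂.injective
    rw [map_mul, map_mul, φ₁₂_fres_left, φ₁₂_fres_right, RingEquiv.apply_symm_apply,
      RingEquiv.apply_symm_apply, RingEquiv.apply_symm_apply]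
    exact hv
  have hu : res L (inf_le_left : D.U₁ ⊓ D.U₂ ≤ D.U₁) (D.φ₁.symm v₁ • e₁) =
      D.φ₁₂.symm (transition (tail F) m G) • res L inf_le_right (D.φ₂.symm v₂ • e₂) := by
    rw [res_smul, res_smul, hw, smul_smul, smul_smul, hw']
  -- The normal form comes with an unknown exponent `m`; the degree `2m = 2n` determines it.
  have hmn : m = n := by
    have := D.degree_eq he₁' he₂' hu (fst_transition _ _ _)
    omega
  subst hmn
  exact ⟨G, D.hasCoordinates_iff.mpr ⟨_, _, he₁', he₂', hu⟩⟩

/-- The line bundle with coordinates `(G_1, …, G_g)`. -/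
def bundle (n : ℕ) (G : Fin g → k) : C.Modules :=
  glueModule ((Units.map (D.φ₁₂.symm : DualNumber k[T;T⁻¹] →* Γ(C, D.U₁ ⊓ D.U₂))
    (transition (tail F) n G) : Γ(C, D.U₁ ⊓ D.U₂)ˣ) : Γ(C, D.U₁ ⊓ D.U₂))

lemma hasCoordinates_bundle (n : ℕ) (G : Fin g → k) : D.HasCoordinates n G (D.bundle n G) :=
  D.hasCoordinates_iff.mpr ⟨_, _, isFrame_glueFrame₁ _, isFrame_glueFrame₂ _, res_glueFrame₁ _⟩

lemma isoClass_eq_isoClass_bundle_iff (n : ℕ) (G : Fin g → k) :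
    isoClass L = isoClass (D.bundle n G) ↔ D.HasCoordinates n G L := by
  rw [isoClass_eq_iff]
  constructor
  · rintro ⟨φ⟩
    exact (D.hasCoordinates_bundle n G).of_iso φ.symm
  · intro h
    obtain ⟨e₁, e₂, he₁, he₂, hu⟩ := D.hasCoordinates_iff.mp h
    exact nonempty_iso_glueModule he₁ he₂ hu D.cover

end Gluing

end RibbonBundles

end Ribbon

end

/-! ### The coordinate bijection and the loci `W^r`. -/

theorem mainTheorem1 {k : Type u} [Field k] [IsAlgClosed k] [CharZero k] {g n : ℕ}
    (hn : (2 * n : ℤ) ≤ (g : ℤ) - 1) (F : Fin (g - 2) → k)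
    {C : Scheme.{u}} {π : C ⟶ Spec (CommRingCat.of k)} (D : Ribbon.Gluing π g F) :
    ∃ Λ : (Fin g → k) → Ribbon.IsoClass C,
      (∀ (G : Fin g → k) (L : C.Modules),
        Ribbon.isoClass L = Λ G ↔ D.HasCoordinates n G L) ∧
      Set.BijOn Λ Set.univ (D.Pic (2 * n)) ∧
      ∀ r : ℕ,
        (∃ I : Ideal (MvPolynomial (Fin g) k),
          Ribbon.locus n r F = MvPolynomial.zeroLocus k I) ∧
        Set.BijOn Λ (Ribbon.locus n r F) (D.W r (2 * n)) := by
  have key := fun (G : Fin g → k) (L : C.Modules) =>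
    D.isoClass_eq_isoClass_bundle_iff (L := L) n G
  have hcoord := fun G => D.hasCoordinates_bundle n G
  have hinj : Function.Injective fun G => Ribbon.isoClass (D.bundle n G) :=
    fun G G' h => (hcoord G).unique ((key G' _).mp h)
  -- From `h⁰ + rank = n + 1`, the inequality `rank ≤ n - r` in `ℤ` is equivalent to `h⁰ ≥ r + 1`,
  -- also when `r > n`. It is proved for every representative `L`, as needed for surjectivity onto
  -- `W^r`.
  have hlocus : ∀ (r : ℕ) (G : Fin g → k) (L : C.Modules), D.HasCoordinates n G L →
      (G ∈ Ribbon.locus n r F ↔ r + 1 ≤ Ribbon.h0 π L) := by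
    intro r G L h
    have h1 := h.h0_add_rank (by omega)
    change ((Ribbon.matrixA n F G).rank : ℤ) ≤ (n : ℤ) - r ↔ _
    omega
  refine ⟨fun G => Ribbon.isoClass (D.bundle n G), key, ⟨?_, hinj.injOn, ?_⟩, fun r =>
    ⟨Ribbon.exists_locus_eq_zeroLocus n r F, ?_, hinj.injOn, ?_⟩⟩
  · exact fun G _ => ⟨_, (hcoord G).isLineBundle, (hcoord G).degree_eq, rfl⟩
  · rintro _ ⟨L, hL, hd, rfl⟩
    obtain ⟨G, hG⟩ := D.exists_hasCoordinates hL hd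
    exact ⟨G, Set.mem_univ G, ((key G L).mpr hG).symm⟩
  · exact fun G hG => ⟨_, (hcoord G).isLineBundle, (hcoord G).degree_eq,
      (hlocus r G _ (hcoord G)).mp hG, rfl⟩
  · rintro _ ⟨L, hL, hd, hr, rfl⟩
    obtain ⟨G, hG⟩ := D.exists_hasCoordinates hL hd
    exact ⟨G, (hlocus r G L hG).mpr hr, ((key G L).mpr hG).symm⟩
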